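/- **Conventions.** Let $(X,d)$ be a complete metric space. Write $\operatorname{Lip}(X)$, $\operatorname{Lip}_b(X)$ and $\mathcal B^\infty(X)$ for the real-valued Lipschitz, bounded Lipschitz, and bounded Borel functions on $X$, $\operatorname{LIP}(\pi)$ for the Lipschitz constant of $\pi$, and $D^k(X)=\operatorname{Lip}_b(X)\times\operatorname{Lip}(X)^k$. A *metric $k$-current* (Ambrosio–Kirchheim) is a multilinear functional $T\colon D^k(X)\to\mathbb R$ such that - (locality) $T(f,\pi_1,\dots,\pi_k)=0$ if some $\pi_i$ is constant on a neighbourhood of $\{f\neq0\}$; - (joint continuity) $T(f,\pi^n_1,\dots,\pi^n_k)\to T(f,\pi_1,\dots,\pi_k)$ whenever $\pi^n_i\to\pi_i$ pointwise for every $i$ and $\sup_{i,n}\operatorname{LIP}(\pi_i^n)<\infty$; - (finite mass) there is a finite Borel measure $\mu$ on $X$ with $|T(f,\pi_1,\dots,\pi_k)|\le\prod_i\operatorname{LIP}(\pi_i)\int|f|\,d\mu$ on $D^k(X)$. The least such $\mu$ is denoted $\|T\|$, and $\mathbb M(T):=\|T\|(X)$. $\mathbf M_k(X)$ is the space of metric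 $k$-currents. Every $T\in\mathbf M_k(X)$ extends canonically, by density of $\operatorname{Lip}_b(X)$ in $L^1(\|T\|)$, to $\mathcal B^\infty(X)\times\operatorname{Lip}(X)^k$. The boundary is $\partial T(f,\pi_1,\dots,\pi_{k-1})=T(1,f,\pi_1,\dots,\pi_{k-1})$, and $\mathbf N_k(X)$ is the set of $T\in\mathbf M_k(X)$ with $\partial T\in\mathbf M_{k-1}(X)$. The flat norm of a functional $T$ on $D^k(X)$ is $$\mathbb F(T)=\inf\{\mathbb M(S)+\mathbb M(R): S\in\mathbf N_{k+1}(X),\ R\in\mathbf M_k(X),\ T=\partial S+R\}.$$ A *conical geodesic bicombing* on $X$ is a map $\sigma\colon X\times X\times[0,1]\to X$, $\sigma_{x,y}(t):=\sigma(x,y,t)$, such that $\sigma_{x,y}(0)=x$, $\sigma_{x,y}(1)=y$, $d(\sigma_{x,y}(s),\sigma_{x,y}(t))=|s-t|\,d(x,y)$, and $d(\sigma_{x,y}(t),\sigma_{x',y'}(t))\le(1-t)d(x,x')+t\,d(y,y')$ for all $x,y,x',y'\in X$ and $s,t\in[0,1]$. For a Lipschitz curve $\gamma\colon[0,1]\to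 X$, $\ell(\gamma)$ is its length and $[\gamma](f,\pi)=\int_0^1 f(\gamma_t)\,(\pi\circ\gamma)'(t)\,dt$. The set $\operatorname{Lip}([0,1];X)$ of Lipschitz curves carries the topology of $d_\infty(\gamma,\gamma')=\max_t d(\gamma_t,\gamma'_t)$. **Lemma 4.1 (simplified homotopy lemma).** Let $(X,d)$ be a complete metric space admitting a conical geodesic bicombing. Then to every pair of Lipschitz curves $\gamma^0,\gamma^1\colon[0,1]\to X$ one can assign metric currents $S_{\gamma^0,\gamma^1}\in\mathbf M_2(X)$ and $R_{\gamma^0,\gamma^1}\in\mathbf M_1(X)$ such that, for all $\gamma^0,\gamma^1$, $$[\gamma^0]-[\gamma^1]=\partial S_{\gamma^0,\gamma^1}+R_{\gamma^0,\gamma^1},$$ $$\mathbb M(S_{\gamma^0,\gamma^1})\le\big(\ell(\gamma^0)+\ell(\gamma^1)\big)\,d_\infty(\gamma^0,\gamma^1),$$ $$\mathbb M(R_{\gamma^0,\gamma^1})\le d(\gamma^0_0,\gamma^1_0)+d(\gamma^0_1,\gamma^1_1)\le2\,d_\infty(\gamma^0,\gamma^1);$$ in particular $$\mathbb F([\gamma^0]-[\gamma^1])\le\big(\ell(\gamma^0)+\ell(\gamma^1)+2\big)\,d_\infty(\gamma^0,\gamma^1).$$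 Moreover, for all $f\in\mathcal B^\infty(X)$ and $\pi_1,\pi_2,\pi\in\operatorname{Lip}(X)$, the maps $(\gamma^0,\gamma^1)\mapsto S_{\gamma^0,\gamma^1}(f,\pi_1,\pi_2)$ and $(\gamma^0,\gamma^1)\mapsto R_{\gamma^0,\gamma^1}(f,\pi)$ are Borel measurable on $\operatorname{Lip}([0,1];X)\times\operatorname{Lip}([0,1];X)$ with the product topology. -/

import Mathlib

open Set Filter Topology MeasureTheory
open scoped NNReal ENNReal unitInterval

/-- The real vector space `Lip(X)` of real-valued Lipschitz functions on `X`. -/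
def LipFun (X : Type*) [MetricSpace X] : Submodule ℝ (X → ℝ) where
  carrier := {f | ∃ K : ℝ≥0, LipschitzWith K f}
  zero_mem' := ⟨0, LipschitzWith.const 0⟩
  add_mem' := by
    rintro f g ⟨K, hK⟩ ⟨L, hL⟩
    exact ⟨K + L, hK.add hL⟩
  smul_mem' := by
    rintro c f ⟨K, hK⟩
    exact ⟨‖c‖₊ * K, (lipschitzWith_smul c).comp hK⟩

/-- The real vector space `Lip_b(X)` of bounded real-valued Lipschitz functions on `X`. -/
def BddLipFun (X : Type*) [MetricSpace X] : Submodule ℝ (X → ℝ) where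
  carrier := {f | (∃ K : ℝ≥0, LipschitzWith K f) ∧ ∃ C : ℝ, ∀ x, |f x| ≤ C}
  zero_mem' := ⟨⟨0, LipschitzWith.const 0⟩, 0, fun x => by simp⟩
  add_mem' := by
    rintro f g ⟨⟨K, hK⟩, C, hC⟩ ⟨⟨L, hL⟩, D, hD⟩
    exact ⟨⟨K + L, hK.add hL⟩, C + D, fun x => (abs_add_le _ _).trans (add_le_add (hC x) (hD x))⟩
  smul_mem' := by
    rintro c f ⟨⟨K, hK⟩, C, hC⟩
    refine ⟨⟨‖c‖₊ * K, (lipschitzWith_smul c).comp hK⟩, |c| * C, fun x => ?_⟩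
    simpa [abs_mul] using mul_le_mul_of_nonneg_left (hC x) (abs_nonneg c)

/-- A bounded Lipschitz function, seen as a Lipschitz function. -/
def BddLipFun.toLip {X : Type*} [MetricSpace X] (f : BddLipFun X) : LipFun X :=
  ⟨f.1, f.2.1⟩

/-- The constant function `1` as a bounded Lipschitz function. -/
def BddLipFun.one (X : Type*) [MetricSpace X] : BddLipFun X :=
  ⟨fun _ => 1, ⟨0, LipschitzWith.const 1⟩, 1, fun _ => by simp⟩

/-- The Lipschitz constant `LIP(π) = sup_{x ≠ y} |π(x) - π(y)| / d(x, y)`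
(a pair with `x = y` contributes `0 / 0 = 0`). -/
noncomputable def lipConst {X : Type*} [MetricSpace X] (π : LipFun X) : ℝ :=
  ⨆ p : X × X, |π.1 p.1 - π.1 p.2| / dist p.1 p.2

/-- Real-valued functionals `(f, π₁, …, π_k) ↦ T(f, π₁, …, π_k)` on
`D^k(X) = Lip_b(X) × Lip(X)^k`; no property is imposed. -/
abbrev Functional (X : Type*) [MetricSpace X] (k : ℕ) : Type _ :=
  BddLipFun X → (Fin k → LipFun X) → ℝ

/-- `T` is linear in each of its `1 + k` arguments. -/
def IsMultilinear {X : Type*} [MetricSpace X] {k : ℕ} (T : Functional X k) : Prop :=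
  ∃ M : BddLipFun X →ₗ[ℝ] MultilinearMap ℝ (fun _ : Fin k => LipFun X) ℝ,
    ∀ f π, T f π = M f π

/-- The finite Borel measure `μ` satisfies
`|T(f, π₁, …, π_k)| ≤ ∏ᵢ LIP(πᵢ) ∫ |f| dμ` for all `(f, π₁, …, π_k)`. -/
def MassBound {X : Type*} [MetricSpace X] [MeasurableSpace X] {k : ℕ}
    (T : Functional X k) (μ : Measure X) : Prop :=
  IsFiniteMeasure μ ∧
    ∀ (f : BddLipFun X) (π : Fin k → LipFun X),
      |T f π| ≤ (∏ i, lipConst (π i)) * ∫ x, |f.1 x| ∂μ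

/-- Metric `k`-currents in the sense of Ambrosio and Kirchheim. -/
structure IsMetricCurrent {X : Type*} [MetricSpace X] [MeasurableSpace X] {k : ℕ}
    (T : Functional X k) : Prop where
  multilinear : IsMultilinear T
  locality : ∀ (f : BddLipFun X) (π : Fin k → LipFun X),
    (∃ i, ∃ c : ℝ, ∃ U : Set X, IsOpen U ∧ {x | f.1 x ≠ 0} ⊆ U ∧ ∀ x ∈ U, (π i).1 x = c) →
      T f π = 0
  joint_continuity : ∀ (f : BddLipFun X) (πs : ℕ → Fin k → LipFun X) (π : Fin k → LipFun X),
    (∃ C : ℝ, ∀ n i, lipConst (πs n i) ≤ C) →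
    (∀ i x, Tendsto (fun n => (πs n i).1 x) atTop (𝓝 ((π i).1 x))) →
      Tendsto (fun n => T f (πs n)) atTop (𝓝 (T f π))
  finite_mass : ∃ μ : Measure X, MassBound T μ

/-- The mass measure `‖T‖`: the least finite Borel measure which bounds `T`, written as the
infimum, in the complete lattice of measures on `X`, of all the finite measures which bound `T`.
If there is none (so `T` is not a current), this is the measure `⊤`. -/
noncomputable def massMeasure {X : Type*} [MetricSpace X] [MeasurableSpace X] {k : ℕ}
    (T : Functional X k) : Measure X :=
  sInf {μ : Measure X | MassBound T μ}

/-- The mass `M(T) = ‖T‖(X)`. -/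
noncomputable def mass {X : Type*} [MetricSpace X] [MeasurableSpace X] {k : ℕ}
    (T : Functional X k) : ℝ≥0∞ :=
  massMeasure T univ

/-- The boundary `∂T(f, π₁, …, π_k) = T(1, f, π₁, …, π_k)`. -/
def boundary {X : Type*} [MetricSpace X] {k : ℕ} (T : Functional X (k + 1)) : Functional X k :=
  fun f π => T (BddLipFun.one X) (Fin.cons (BddLipFun.toLip f) π)

/-- Normal currents: metric currents whose boundary is a metric current. -/
def IsNormalCurrent {X : Type*} [MetricSpace X] [MeasurableSpace X] {k : ℕ}
    (T : Functional X (k + 1)) : Prop :=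
  IsMetricCurrent T ∧ IsMetricCurrent (boundary T)

/-- The flat norm: the infimum of `M(S) + M(R)` over all decompositions `T = ∂S + R` with `S` a
normal `(k+1)`-current and `R` a metric `k`-current. -/
noncomputable def flatNorm {X : Type*} [MetricSpace X] [MeasurableSpace X] {k : ℕ}
    (T : Functional X k) : ℝ≥0∞ :=
  ⨅ (S : Functional X (k + 1)) (R : Functional X k)
    (_ : IsNormalCurrent S ∧ IsMetricCurrent R ∧ T = boundary S + R), mass S + mass R

/-- `a` is the value at `(f, π₁, …, π_k)`, where `f` is a bounded Borel function, of the canonical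
extension of `T`: it is the limit of `T(uₙ, π₁, …, π_k)` for bounded Lipschitz functions `uₙ`
converging to `f` in `L¹(μ)`, where `μ` is a finite Borel measure that bounds `T`. -/
def IsBorelExtValue {X : Type*} [MetricSpace X] [MeasurableSpace X] {k : ℕ}
    (T : Functional X k) (f : X → ℝ) (π : Fin k → LipFun X) (a : ℝ) : Prop :=
  ∃ μ : Measure X, MassBound T μ ∧ ∃ u : ℕ → BddLipFun X,
    Tendsto (fun n => ∫⁻ x, ‖(u n).1 x - f x‖ₑ ∂μ) atTop (𝓝 0) ∧
    Tendsto (fun n => T (u n) π) atTop (𝓝 a)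

open Classical in
/-- The canonical extension of a metric current `T` from `Lip_b(X) × Lip(X)^k` to
`B^∞(X) × Lip(X)^k`, where `B^∞(X)` is the space of bounded Borel functions. For a current and a
bounded Borel `f`, the value exists and is unique (and does not depend on the choice of `μ`),
because `Lip_b(X)` is dense in `L¹(μ)` for every finite Borel measure `μ` on a metric space, and
because the sum of two measures which bound `T` bounds `T` as well. -/
noncomputable def borelExt {X : Type*} [MetricSpace X] [MeasurableSpace X] {k : ℕ}
    (T : Functional X k) (f : X → ℝ) (π : Fin k → LipFun X) : ℝ :=
  if h : ∃ a, IsBorelExtValue T f π a then h.choose else 0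

/-- Lipschitz curves `[0,1] → X`, as a subspace of `C([0,1], X)` with the uniform distance `d_∞`;
in particular `dist γ⁰ γ¹` and `edist γ⁰ γ¹` are `d_∞(γ⁰, γ¹)`. -/
abbrev LipCurve (X : Type*) [MetricSpace X] : Type _ :=
  {γ : C(I, X) // ∃ K : ℝ≥0, LipschitzWith K γ}

/-- The length of a curve: the supremum of `∑ᵢ d(γ(tᵢ₋₁), γ(tᵢ))` over finite ordered
families of parameters. -/
noncomputable def curveLength {X : Type*} [MetricSpace X] (γ : LipCurve X) : ℝ≥0∞ :=
  eVariationOn (fun t : I => γ.1 t) univ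

/-- The functional `⟦γ⟧(f, π) = ∫₀¹ f(γ(t)) (π ∘ γ)'(t) dt` induced by a Lipschitz curve `γ`.
(The curve is extended to `ℝ` by constants, which does not affect the derivative in `(0,1)`.) -/
noncomputable def curveCurrent {X : Type*} [MetricSpace X] (γ : LipCurve X) : Functional X 1 :=
  fun f π => ∫ t in (0 : ℝ)..1,
    f.1 (γ.1 (projIcc 0 1 zero_le_one t)) *
      deriv (fun s : ℝ => (π 0).1 (γ.1 (projIcc 0 1 zero_le_one s))) t

/-- `bic` is a conical geodesic bicombing on `X`: each `bic x y` is a constant speed geodesic from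
`x` to `y`, and `d(bic x y t, bic x' y' t) ≤ (1 - t) d(x, x') + t d(y, y')`. -/
structure IsConicalGeodesicBicombing {X : Type*} [MetricSpace X] (bic : X → X → I → X) : Prop where
  source : ∀ x y, bic x y 0 = x
  target : ∀ x y, bic x y 1 = y
  geodesic : ∀ x y (s t : I), dist (bic x y s) (bic x y t) = |(s : ℝ) - t| * dist x y
  conical : ∀ x y x' y' (t : I),
    dist (bic x y t) (bic x' y' t) ≤ (1 - (t : ℝ)) * dist x x' + (t : ℝ) * dist y y'

/-! Join the curves by the geodesic homotopy `H(s, t) = bic (γ₀ s) (γ₁ s) t` on the unit square and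
let `S` be the push-forward of the square: `S(f, π₁, π₂)` is the integral of `f ∘ H` against the
Jacobian of `(π₁ ∘ H, π₂ ∘ H)`. Green's formula identifies `∂S` with the four edges. The edges `t =
0` and `t = 1` give `⟦γ₀⟧ - ⟦γ₁⟧`; the other two are the geodesics between initial points and
between final points, whose difference is `R`.

For the mass of `S`, the `t`-derivative of `π ∘ H` is at most `LIP(π) d_∞`, since each `t ↦ H(s, t)`
is a geodesic. By conicality the `s`-derivative is at most `LIP(π)` times `(1 - t) Λ₀'(s) + t
Λ₁'(s)`, with `Λᵢ` the length function of `γᵢ`. The Jacobian has two terms of this size, and the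
factor 2 cancels against `∫ (1 - t) = ∫ t = 1/2`.

The delicate axiom is joint continuity: pointwise convergence of equi-Lipschitz functions does not
make their derivatives converge. Jacobians are nevertheless weakly continuous, because integration
by parts moves the derivatives off the converging factor (`tendsto_integral_mul_planarJacobian`).
Everything rests on the symmetry of mixed derivatives for Lipschitz functions,
`LipschitzWith.integral_lineDeriv_mul_lineDeriv_comm`. To avoid boundary terms, maps are extended to
the line or plane by constants, and cutoffs equal to 1 on the interval or square are inserted;
`integral_planarJacobian_eq_boundary` reads the edges off the derivative of the cutoff.

On bounded Borel `f` the extended currents are given by the same integrals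
(`IsCurrentDensity.borelExt_eq`). Their integrands are jointly measurable in the curves and the
parameters, so the integrals are Borel in the curves. -/

/-! ### Integration by parts for Lipschitz functions -/

section LipschitzCalculus

/-- The product of a compactly supported Lipschitz function and a Lipschitz function is Lipschitz. -/
theorem LipschitzWith.exists_mul_of_hasCompactSupport {α : Type*} [PseudoMetricSpace α]
    {f g : α → ℝ} {C D : ℝ≥0} (hf : LipschitzWith C f) (h'f : HasCompactSupport f)
    (hg : LipschitzWith D g) : ∃ K : ℝ≥0, LipschitzWith K (fun x => f x * g x) := by
  obtain ⟨A, hA⟩ := h'f.exists_bound_of_continuous hf.continuous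
  obtain ⟨B, hB⟩ := IsCompact.exists_bound_of_continuousOn h'f hg.continuous.continuousOn
  have key : ∀ x y, x ∈ tsupport f → dist (f x * g x) (f y * g y) ≤
      (C * |B| + |A| * D) * dist x y := by
    intro x y hx
    have h1 : |f x - f y| ≤ C * dist x y := by simpa [Real.dist_eq] using hf.dist_le_mul x y
    have h2 : |g x - g y| ≤ D * dist x y := by simpa [Real.dist_eq] using hg.dist_le_mul x y
    have h3 : |g x| ≤ |B| := (hB x hx).trans (le_abs_self B)
    have h4 : |f y| ≤ |A| := (hA y).trans (le_abs_self A)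
    calc dist (f x * g x) (f y * g y) = |(f x - f y) * g x + f y * (g x - g y)| := by
          rw [Real.dist_eq]; ring_nf
      _ ≤ |f x - f y| * |g x| + |f y| * |g x - g y| := by
          rw [← abs_mul, ← abs_mul]; exact abs_add_le _ _
      _ ≤ (C * dist x y) * |B| + |A| * (D * dist x y) := by gcongr
      _ = _ := by ring
  refine ⟨⟨C * |B| + |A| * D, by positivity⟩, LipschitzWith.of_dist_le_mul fun x y => ?_⟩
  change _ ≤ (C * |B| + |A| * D) * dist x y
  by_cases hx : x ∈ tsupport f
  · exact key x y hx
  by_cases hy : y ∈ tsupport f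
  · rw [dist_comm, dist_comm x y]
    exact key y x hy
  · rw [image_eq_zero_of_notMem_tsupport hx, image_eq_zero_of_notMem_tsupport hy]
    simp only [zero_mul, dist_self]
    positivity

theorem lineDeriv_eq_zero_of_notMem_tsupport {E : Type*} [NormedAddCommGroup E]
    [NormedSpace ℝ E] {f : E → ℝ} {x : E} (hx : x ∉ tsupport f) (a : E) :
    lineDeriv ℝ f x a = 0 := by
  have h : f =ᶠ[𝓝 x] fun _ => 0 := notMem_tsupport_iff_eventuallyEq.mp hx
  rw [h.lineDeriv_eq]
  simp [lineDeriv]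

/-- Equi-Lipschitz functions which converge pointwise to zero converge weakly to zero against
bounded sequences of functions supported in a fixed compact set. -/
theorem tendsto_integral_mul_zero_of_lipschitzWith {E : Type*} [MetricSpace E]
    [MeasurableSpace E] [BorelSpace E] {μ : Measure E}
    [IsFiniteMeasureOnCompacts μ] {L : ℝ≥0} {h g : ℕ → E → ℝ} {K : Set E} {B : ℝ}
    (hh : ∀ n, LipschitzWith L (h n)) (hlim : ∀ x, Tendsto (fun n => h n x) atTop (𝓝 0))
    (hg : ∀ n, AEStronglyMeasurable (g n) μ) (hK : IsCompact K) (hgB : ∀ n x, |g n x| ≤ B)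
    (hgK : ∀ n, ∀ x ∉ K, g n x = 0) :
    Tendsto (fun n => ∫ x, h n x * g n x ∂μ) atTop (𝓝 0) := by
  rcases K.eq_empty_or_nonempty with rfl | ⟨x₀, hx₀⟩
  · simp [hgK]
  have hB : 0 ≤ B := (abs_nonneg _).trans (hgB 0 x₀)
  -- Convergence at the single point `x₀` and the common Lipschitz constant give an envelope of
  -- linear growth, integrable on the compact set `K`.
  obtain ⟨M, hM⟩ := (hlim x₀).abs.bddAbove_range
  have hM' : ∀ n, |h n x₀| ≤ M := fun n => hM ⟨n, rfl⟩
  have hM0 : 0 ≤ M := (abs_nonneg _).trans (hM' 0)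
  have hbound : ∀ n x, |h n x| ≤ M + L * dist x x₀ := fun n x => by
    have h1 := (hh n).dist_le_mul x x₀
    rw [Real.dist_eq] at h1
    have h2 : |h n x| ≤ |h n x - h n x₀| + |h n x₀| := by
      simpa using abs_add_le (h n x - h n x₀) (h n x₀)
    linarith [hM' n]
  rw [show (0 : ℝ) = ∫ _ : E, (0 : ℝ) ∂μ by simp]
  refine tendsto_integral_of_dominated_convergence
    (K.indicator fun x => (M + L * dist x x₀) * B) (fun n => ?_) ?_ (fun n => ?_) ?_
  · exact (hh n).continuous.aestronglyMeasurable.mul (hg n)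
  · rw [integrable_indicator_iff hK.measurableSet]
    exact ContinuousOn.integrableOn_compact hK (by fun_prop)
  · refine .of_forall fun x => ?_
    by_cases hx : x ∈ K
    · rw [indicator_of_mem hx, norm_mul, Real.norm_eq_abs, Real.norm_eq_abs]
      exact mul_le_mul (hbound n x) (hgB n x) (abs_nonneg _) (by positivity)
    · simp [hgK n x hx, hx]
  · refine .of_forall fun x => ?_
    refine squeeze_zero_norm (a := fun n => |h n x| * B) (fun n => ?_) ?_
    · rw [norm_mul, Real.norm_eq_abs, Real.norm_eq_abs]
      exact mul_le_mul_of_nonneg_left (hgB n x) (abs_nonneg _)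
    · simpa using (hlim x).abs.mul_const B

variable {E : Type*} [NormedAddCommGroup E] [NormedSpace ℝ E] [MeasurableSpace E] [BorelSpace E]
  [FiniteDimensional ℝ E] {μ : Measure E} [μ.IsAddHaarMeasure]

theorem LipschitzWith.integrable_lineDeriv_of_hasCompactSupport {w : E → ℝ} {C : ℝ≥0}
    (hw : LipschitzWith C w) (h'w : HasCompactSupport w) (a : E) :
    Integrable (fun x => lineDeriv ℝ w x a) μ := by
  rw [← integrableOn_iff_integrable_of_support_subset (s := tsupport w)]
  · exact (hw.locallyIntegrable_lineDeriv a).integrableOn_isCompact h'w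
  · intro x hx
    by_contra h
    exact hx (lineDeriv_eq_zero_of_notMem_tsupport h a)

/-- Integration by parts twice: the two mixed products of first derivatives of two Lipschitz
functions, one of them with compact support, have the same integral. -/
theorem LipschitzWith.integral_lineDeriv_mul_lineDeriv_comm {w v : E → ℝ} {C D : ℝ≥0}
    (hw : LipschitzWith C w) (h'w : HasCompactSupport w) (hv : LipschitzWith D v) (a b : E) :
    ∫ x, lineDeriv ℝ w x a * lineDeriv ℝ v x b ∂μ =
      ∫ x, lineDeriv ℝ w x b * lineDeriv ℝ v x a ∂μ := by
  -- No second derivatives exist, so the derivative along `b` is replaced by a difference quotient,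
  -- which translation invariance moves from `v` to `w`. The set `K` contains the supports of `w`
  -- and of its translates by `t • b`, `0 < t ≤ 1`; truncating to `K` makes the derivative of `v`
  -- integrable.
  set K := Metric.cthickening ‖b‖ (tsupport w)
  have hK : IsCompact K := h'w.cthickening
  set g : E → ℝ := K.indicator fun x => lineDeriv ℝ v x a
  have hg : Integrable g μ := by
    rw [integrable_indicator_iff hK.measurableSet]
    exact (hv.locallyIntegrable_lineDeriv a).integrableOn_isCompact hK
  have hwa : Integrable (fun x => lineDeriv ℝ w x a) μ :=
    hw.integrable_lineDeriv_of_hasCompactSupport h'w a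
  have lim₁ := hv.integral_inv_smul_sub_mul_tendsto_integral_lineDeriv_mul hwa b
  have lim₂ := (hw.integral_inv_smul_sub_mul_tendsto_integral_lineDeriv_mul hg (-b)).neg
  have hlim₂ : -∫ x, lineDeriv ℝ w x (-b) * g x ∂μ =
      ∫ x, lineDeriv ℝ w x b * lineDeriv ℝ v x a ∂μ := by
    rw [← integral_neg]
    congr 1 with x
    rw [lineDeriv_neg]
    by_cases hx : x ∈ K
    · simp [g, hx]
    · rw [lineDeriv_eq_zero_of_notMem_tsupport
        (fun h => hx (Metric.self_subset_cthickening _ h))]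
      simp
  rw [hlim₂] at lim₂
  simp_rw [mul_comm (lineDeriv ℝ w _ a)]
  refine tendsto_nhds_unique lim₁ (lim₂.congr' ?_)
  filter_upwards [Ioc_mem_nhdsGT zero_lt_one] with t ht
  have hsupp : ∀ x ∉ K, w x = 0 ∧ w (x + t • -b) = 0 := by
    intro x hx
    refine ⟨image_eq_zero_of_notMem_tsupport fun h => hx (Metric.self_subset_cthickening _ h),
      image_eq_zero_of_notMem_tsupport fun h => hx ?_⟩
    refine Metric.mem_cthickening_of_dist_le _ _ ‖b‖ _ h ?_
    simp only [dist_eq_norm, sub_add_cancel_left, norm_neg, norm_smul, Real.norm_eq_abs,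
      abs_of_nonneg ht.1.le, smul_neg]
    exact mul_le_of_le_one_left (norm_nonneg b) ht.2
  have hvt : LipschitzWith D fun x => v (x + t • b) := by
    simpa [Function.comp_def] using hv.comp ((LipschitzWith.id).add (LipschitzWith.const (t • b)))
  have hwb : HasCompactSupport fun x => w (x + t • -b) :=
    h'w.comp_homeomorph (Homeomorph.addRight (t • -b))
  have hwbc : Continuous fun x => w (x + t • -b) := hw.continuous.comp (continuous_add_const _)
  have parts : ∀ {u : E → ℝ} {L : ℝ≥0}, LipschitzWith L u →
      ∫ x, u x * lineDeriv ℝ w x a ∂μ = -∫ x, lineDeriv ℝ u x a * w x ∂μ := by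
    intro u L hu
    rw [hu.integral_lineDeriv_mul_eq hw h'w, ← integral_neg]
    congr 1 with x
    rw [lineDeriv_neg]
    ring
  have hI : ∀ {w' : E → ℝ}, Continuous w' → HasCompactSupport w' →
      Integrable (fun x => w' x * lineDeriv ℝ v x a) μ := fun hc hs =>
    (hc.integrable_of_hasCompactSupport hs).mul_of_top_left (hv.memLp_lineDeriv a)
  -- Integrate by parts along `a`, then translate by `t • b`: this trades the shift of `v` for the
  -- opposite shift of `w`.
  have shift : ∫ x, v (x + t • b) * lineDeriv ℝ w x a ∂μ =
      -∫ x, w (x + t • -b) * lineDeriv ℝ v x a ∂μ := by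
    rw [parts hvt, ← integral_add_right_eq_self (fun x => w (x + t • -b) * _) (t • b)]
    congr 2 with x
    have : lineDeriv ℝ (fun x => v (x + t • b)) x a = lineDeriv ℝ v (x + t • b) a := by
      simp only [lineDeriv]
      congr 1 with s
      congr 1
      abel
    rw [this]
    simp [mul_comm]
  have unshift : ∫ x, v x * lineDeriv ℝ w x a ∂μ = -∫ x, w x * lineDeriv ℝ v x a ∂μ := by
    rw [parts hv]
    simp_rw [mul_comm (w _)]
  have e₁ : ∫ x, (t⁻¹ • (w (x + t • -b) - w x)) * g x ∂μ =
      t⁻¹ * (∫ x, w (x + t • -b) * lineDeriv ℝ v x a ∂μ - ∫ x, w x * lineDeriv ℝ v x a ∂μ) := by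
    rw [← integral_sub (hI hwbc hwb) (hI hw.continuous h'w), ← integral_const_mul]
    congr 1 with x
    by_cases hx : x ∈ K
    · simp only [g, hx, indicator_of_mem, smul_eq_mul]
      ring
    · rw [(hsupp x hx).1, (hsupp x hx).2]
      simp
  have e₂ : ∫ x, (t⁻¹ • (v (x + t • b) - v x)) * lineDeriv ℝ w x a ∂μ =
      t⁻¹ * (∫ x, v (x + t • b) * lineDeriv ℝ w x a ∂μ - ∫ x, v x * lineDeriv ℝ w x a ∂μ) := by
    have hJ : ∀ {v' : E → ℝ}, Continuous v' →
        Integrable (fun x => v' x * lineDeriv ℝ w x a) μ := by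
      intro v' hv'
      rw [← integrableOn_iff_integrable_of_support_subset (s := tsupport w)]
      · exact hwa.integrableOn.continuousOn_mul hv'.continuousOn h'w
      · intro x hx
        by_contra h
        exact hx (by simp [lineDeriv_eq_zero_of_notMem_tsupport h a])
    rw [← integral_sub (hJ hvt.continuous) (hJ hv.continuous), ← integral_const_mul]
    congr 1 with x
    simp only [smul_eq_mul]
    ring
  rw [e₁, e₂, shift, unshift]
  ring

end LipschitzCalculus

/-! ### Jacobians in the plane and their weak continuity -/

section PlanarJacobian

/-- The Jacobian determinant of `(u, v) : ℝ² → ℝ²`, in terms of partial derivatives. -/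
noncomputable def planarJacobian (u v : ℝ × ℝ → ℝ) (x : ℝ × ℝ) : ℝ :=
  lineDeriv ℝ u x (1, 0) * lineDeriv ℝ v x (0, 1) -
    lineDeriv ℝ u x (0, 1) * lineDeriv ℝ v x (1, 0)

theorem planarJacobian_swap (u v : ℝ × ℝ → ℝ) (x : ℝ × ℝ) :
    planarJacobian u v x = -planarJacobian v u x := by
  simp only [planarJacobian]
  ring

theorem lineDeriv_prod_one_zero (u : ℝ × ℝ → ℝ) (x : ℝ × ℝ) :
    lineDeriv ℝ u x (1, 0) = deriv (fun r => u (r, x.2)) x.1 := by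
  obtain ⟨s, t⟩ := x
  have := deriv_comp_const_add (fun r => u (r, t)) s 0
  simpa [lineDeriv] using this

theorem lineDeriv_prod_zero_one (u : ℝ × ℝ → ℝ) (x : ℝ × ℝ) :
    lineDeriv ℝ u x (0, 1) = deriv (fun r => u (x.1, r)) x.2 := by
  obtain ⟨s, t⟩ := x
  have := deriv_comp_const_add (fun r => u (s, r)) t 0
  simpa [lineDeriv] using this

theorem measurable_planarJacobian {u v : ℝ × ℝ → ℝ} (hu : Continuous u) (hv : Continuous v) :
    Measurable (planarJacobian u v) :=
  ((measurable_lineDeriv hu).mul (measurable_lineDeriv hv)).sub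
    ((measurable_lineDeriv hu).mul (measurable_lineDeriv hv))

theorem LipschitzWith.abs_lineDeriv_le {E : Type*} [NormedAddCommGroup E] [NormedSpace ℝ E]
    {u : E → ℝ} {C : ℝ≥0} (hu : LipschitzWith C u) (x : E) {a : E} (ha : ‖a‖ ≤ 1) :
    |lineDeriv ℝ u x a| ≤ C :=
  (norm_lineDeriv_le_of_lipschitz ℝ hu).trans (mul_le_of_le_one_right C.2 ha)

theorem abs_planarJacobian_le {u v : ℝ × ℝ → ℝ} {C D : ℝ≥0} (hu : LipschitzWith C u)
    (hv : LipschitzWith D v) (x : ℝ × ℝ) : |planarJacobian u v x| ≤ 2 * C * D := by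
  have h10 : ‖((1, 0) : ℝ × ℝ)‖ ≤ 1 := by simp [Prod.norm_def]
  have h01 : ‖((0, 1) : ℝ × ℝ)‖ ≤ 1 := by simp [Prod.norm_def]
  have e₁ := mul_le_mul (hu.abs_lineDeriv_le x h10) (hv.abs_lineDeriv_le x h01) (abs_nonneg _) C.2
  have e₂ := mul_le_mul (hu.abs_lineDeriv_le x h01) (hv.abs_lineDeriv_le x h10) (abs_nonneg _) C.2
  rw [← abs_mul] at e₁ e₂
  refine (abs_sub _ _).trans ?_
  change _ ≤ (C : ℝ) * D at e₁
  change _ ≤ (C : ℝ) * D at e₂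
  linarith

theorem planarJacobian_eq_zero_of_notMem_tsupport {u v : ℝ × ℝ → ℝ} {x : ℝ × ℝ}
    (hx : x ∉ tsupport u) : planarJacobian u v x = 0 := by
  simp [planarJacobian, lineDeriv_eq_zero_of_notMem_tsupport hx]

/-- Linearity holds only almost everywhere: it needs both functions to be differentiable along the
axes, which Rademacher's theorem grants off a null set. -/
theorem planarJacobian_ae_linear_left {u u' v : ℝ × ℝ → ℝ} {C C' : ℝ≥0}
    (hu : LipschitzWith C u) (hu' : LipschitzWith C' u') (a b : ℝ) :
    planarJacobian (fun x => a * u x + b * u' x) v =ᵐ[volume]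
      fun x => a * planarJacobian u v x + b * planarJacobian u' v x := by
  filter_upwards [hu.ae_lineDifferentiableAt (μ := volume) (1, 0),
    hu.ae_lineDifferentiableAt (μ := volume) (0, 1),
    hu'.ae_lineDifferentiableAt (μ := volume) (1, 0),
    hu'.ae_lineDifferentiableAt (μ := volume) (0, 1)] with x h₁ h₂ h₃ h₄
  have key : ∀ e, LineDifferentiableAt ℝ u x e → LineDifferentiableAt ℝ u' x e →
      lineDeriv ℝ (fun x => a * u x + b * u' x) x e =
        a * lineDeriv ℝ u x e + b * lineDeriv ℝ u' x e := fun e k k' => by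
    have d : HasDerivAt (fun t : ℝ => u (x + t • e)) (lineDeriv ℝ u x e) 0 := k.hasLineDerivAt
    have d' : HasDerivAt (fun t : ℝ => u' (x + t • e)) (lineDeriv ℝ u' x e) 0 := k'.hasLineDerivAt
    exact ((d.const_mul a).add (d'.const_mul b)).deriv
  simp only [planarJacobian, key _ h₁ h₃, key _ h₂ h₄]
  ring

theorem integrable_mul_planarJacobian {φ u v : ℝ × ℝ → ℝ} {C D : ℝ≥0} (hφ : Continuous φ)
    (h'φ : HasCompactSupport φ) (hu : LipschitzWith C u) (hv : LipschitzWith D v) :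
    Integrable fun x => φ x * planarJacobian u v x :=
  (hφ.integrable_of_hasCompactSupport h'φ).mul_bdd
    (measurable_planarJacobian hu.continuous hv.continuous).aestronglyMeasurable
    (.of_forall (abs_planarJacobian_le hu hv))

/-- Stokes' theorem on the plane for Lipschitz functions. -/
theorem integral_planarJacobian_eq_zero {w v : ℝ × ℝ → ℝ} {C D : ℝ≥0} (hw : LipschitzWith C w)
    (h'w : HasCompactSupport w) (hv : LipschitzWith D v) :
    ∫ x, planarJacobian w v x = 0 := by
  have hI : ∀ a b, Integrable fun x => lineDeriv ℝ w x a * lineDeriv ℝ v x b := fun a b =>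
    (hw.integrable_lineDeriv_of_hasCompactSupport h'w a).mul_of_top_left (hv.memLp_lineDeriv b)
  simp only [planarJacobian]
  rw [integral_sub (hI _ _) (hI _ _), hw.integral_lineDeriv_mul_lineDeriv_comm h'w hv, sub_self]

/-- Stokes' theorem for the compactly supported product `φ u`, expanded by the Leibniz rule. The
gain is that `u` is no longer differentiated. -/
theorem integral_mul_planarJacobian {φ u v : ℝ × ℝ → ℝ} {B C D : ℝ≥0} (hφ : LipschitzWith B φ)
    (h'φ : HasCompactSupport φ) (hu : LipschitzWith C u) (hv : LipschitzWith D v) :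
    ∫ x, φ x * planarJacobian u v x = -∫ x, u x * planarJacobian φ v x := by
  obtain ⟨K, hK⟩ := hφ.exists_mul_of_hasCompactSupport h'φ hu
  have h := integral_planarJacobian_eq_zero hK h'φ.mul_right hv
  have hprod : planarJacobian (fun x => φ x * u x) v =ᵐ[volume]
      fun x => φ x * planarJacobian u v x + u x * planarJacobian φ v x := by
    filter_upwards [hu.ae_lineDifferentiableAt (μ := volume) (1, 0),
      hu.ae_lineDifferentiableAt (μ := volume) (0, 1),
      hφ.ae_lineDifferentiableAt (μ := volume) (1, 0),
      hφ.ae_lineDifferentiableAt (μ := volume) (0, 1)] with x h₁ h₂ h₃ h₄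
    have key : ∀ e, LineDifferentiableAt ℝ u x e → LineDifferentiableAt ℝ φ x e →
        lineDeriv ℝ (fun x => φ x * u x) x e =
          lineDeriv ℝ φ x e * u x + φ x * lineDeriv ℝ u x e := fun e k k' => by
      have d : HasDerivAt (fun t : ℝ => u (x + t • e)) (lineDeriv ℝ u x e) 0 := k.hasLineDerivAt
      have d' : HasDerivAt (fun t : ℝ => φ (x + t • e)) (lineDeriv ℝ φ x e) 0 := k'.hasLineDerivAt
      have := (d'.mul d).deriv
      simp only [zero_smul, add_zero] at this
      exact this
    simp only [planarJacobian, key _ h₁ h₃, key _ h₂ h₄]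
    ring
  have hI : Integrable fun x => u x * planarJacobian φ v x := by
    rw [← integrableOn_iff_integrable_of_support_subset (s := tsupport φ)]
    · refine Integrable.mul_bdd (c := 2 * B * D)
        (hu.continuous.continuousOn.integrableOn_compact h'φ)
        (measurable_planarJacobian hφ.continuous hv.continuous).aestronglyMeasurable
        (.of_forall (abs_planarJacobian_le hφ hv))
    · intro x hx
      by_contra h
      exact hx (by simp [planarJacobian_eq_zero_of_notMem_tsupport h])
  rw [integral_congr_ae hprod,
    integral_add (integrable_mul_planarJacobian hφ.continuous h'φ hu hv) hI] at h
  linarith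

/-- Weak continuity of Jacobian determinants. -/
theorem tendsto_integral_mul_planarJacobian {φ u v : ℝ × ℝ → ℝ} {un vn : ℕ → ℝ × ℝ → ℝ}
    {B C C' D D' : ℝ≥0} (hφ : LipschitzWith B φ) (h'φ : HasCompactSupport φ)
    (hun : ∀ n, LipschitzWith C (un n)) (hvn : ∀ n, LipschitzWith D (vn n))
    (hu : LipschitzWith C' u) (hv : LipschitzWith D' v)
    (hulim : ∀ x, Tendsto (fun n => un n x) atTop (𝓝 (u x)))
    (hvlim : ∀ x, Tendsto (fun n => vn n x) atTop (𝓝 (v x))) :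
    Tendsto (fun n => ∫ x, φ x * planarJacobian (un n) (vn n) x) atTop
      (𝓝 (∫ x, φ x * planarJacobian u v x)) := by
  have hI : ∀ {p q : ℝ × ℝ → ℝ} {P Q : ℝ≥0}, LipschitzWith P p → LipschitzWith Q q →
      Integrable fun x => p x * planarJacobian φ q x := by
    intro p q P Q hp hq
    rw [← integrableOn_iff_integrable_of_support_subset (s := tsupport φ)]
    · refine Integrable.mul_bdd (c := 2 * B * Q)
        (hp.continuous.continuousOn.integrableOn_compact h'φ)
        (measurable_planarJacobian hφ.continuous hq.continuous).aestronglyMeasurable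
        (.of_forall (abs_planarJacobian_le hφ hq))
    · intro x hx
      by_contra h
      exact hx (by simp [planarJacobian_eq_zero_of_notMem_tsupport h])
  -- The second entry `q n` may vary: only the uniform bound and the support of its Jacobian with
  -- `φ` matter.
  have hzero : ∀ {p : ℝ × ℝ → ℝ} {pn q : ℕ → ℝ × ℝ → ℝ} {P P' Q : ℝ≥0},
      (∀ n, LipschitzWith P (pn n)) → LipschitzWith P' p → (∀ n, LipschitzWith Q (q n)) →
      (∀ x, Tendsto (fun n => pn n x) atTop (𝓝 (p x))) →
      Tendsto (fun n => ∫ x, (pn n x - p x) * planarJacobian φ (q n) x) atTop (𝓝 0) := by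
    intro p pn q P P' Q hpn hp hq hlim
    refine tendsto_integral_mul_zero_of_lipschitzWith (L := P + P') (K := tsupport φ)
      (B := 2 * B * Q) (fun n => (hpn n).sub hp) (fun x => ?_) (fun n => ?_) h'φ
      (fun n => abs_planarJacobian_le hφ (hq n))
      (fun n x hx => planarJacobian_eq_zero_of_notMem_tsupport hx)
    · simpa using (hlim x).sub_const (p x)
    · exact (measurable_planarJacobian hφ.continuous (hq n).continuous).aestronglyMeasurable
  have h₁ := hzero hun hu hvn hulim
  have h₂ := hzero hvn hv (fun _ => hu) hvlim
  -- Telescoping `J(uₙ, vₙ) - J(u, v) = J(uₙ - u, vₙ) + J(u, vₙ - v)`, each term then integrated by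
  -- parts so that the vanishing difference stands undifferentiated.
  have e : ∀ n, ∫ x, φ x * planarJacobian (un n) (vn n) x =
      (∫ x, φ x * planarJacobian u v x) + (∫ x, (vn n x - v x) * planarJacobian φ u x) -
        ∫ x, (un n x - u x) * planarJacobian φ (vn n) x := by
    intro n
    have anti : ∀ {q : ℝ × ℝ → ℝ} {Q : ℝ≥0}, LipschitzWith Q q →
        ∫ x, q x * planarJacobian φ u x = ∫ x, φ x * planarJacobian u q x := by
      intro q Q hq
      rw [← neg_eq_iff_eq_neg.mpr (integral_mul_planarJacobian hφ h'φ hq hu),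
        ← integral_neg]
      congr 1 with x
      rw [planarJacobian_swap u q]
      ring
    simp_rw [sub_mul]
    rw [integral_sub (hI (hvn n) hu) (hI hv hu), integral_sub (hI (hun n) (hvn n)) (hI hu (hvn n)),
      anti (hvn n), anti hv, integral_mul_planarJacobian hφ h'φ (hun n) (hvn n),
      integral_mul_planarJacobian hφ h'φ hu (hvn n)]
    ring
  simp_rw [e]
  simpa using (tendsto_const_nhds.add h₂).sub h₁

/-- One-dimensional weak continuity of derivatives of Lipschitz functions. -/
theorem tendsto_integral_mul_deriv {φ v : ℝ → ℝ} {vn : ℕ → ℝ → ℝ} {B D D' : ℝ≥0}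
    (hφ : LipschitzWith B φ) (h'φ : HasCompactSupport φ) (hvn : ∀ n, LipschitzWith D (vn n))
    (hv : LipschitzWith D' v) (hlim : ∀ x, Tendsto (fun n => vn n x) atTop (𝓝 (v x))) :
    Tendsto (fun n => ∫ x, φ x * deriv (vn n) x) atTop (𝓝 (∫ x, φ x * deriv v x)) := by
  have hd : ∀ (w : ℝ → ℝ) x, lineDeriv ℝ w x 1 = deriv w x := fun w x => by
    have := deriv_comp_const_add w x 0
    simpa [lineDeriv] using this
  have parts : ∀ {w : ℝ → ℝ} {Q : ℝ≥0}, LipschitzWith Q w →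
      ∫ x, φ x * deriv w x = -∫ x, w x * deriv φ x := by
    intro w Q hw
    have := hw.integral_lineDeriv_mul_eq (μ := volume) hφ h'φ 1
    simp only [lineDeriv_neg, hd] at this
    simp_rw [mul_comm (φ _), mul_comm (w _), this, neg_mul, integral_neg]
  have hint : ∀ {w : ℝ → ℝ} {Q : ℝ≥0}, LipschitzWith Q w → Integrable fun x => w x * deriv φ x := by
    intro w Q hw
    have hi : Integrable (fun x => deriv φ x) := by
      simpa only [hd] using
        hφ.integrable_lineDeriv_of_hasCompactSupport (μ := volume) h'φ 1
    rw [← integrableOn_iff_integrable_of_support_subset (s := tsupport φ)]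
    · exact hi.integrableOn.continuousOn_mul hw.continuous.continuousOn h'φ
    · intro x hx
      by_contra h
      exact hx (by simp [← hd, lineDeriv_eq_zero_of_notMem_tsupport h])
  have h₁ : Tendsto (fun n => ∫ x, (vn n x - v x) * deriv φ x) atTop (𝓝 0) := by
    refine tendsto_integral_mul_zero_of_lipschitzWith (L := D + D') (K := tsupport φ) (B := B)
      (fun n => (hvn n).sub hv) (fun x => by simpa using (hlim x).sub_const (v x))
      (fun n => (measurable_deriv φ).aestronglyMeasurable) h'φ (fun n x => ?_)
      (fun n x hx => ?_)
    · rw [← hd]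
      exact hφ.abs_lineDeriv_le x (by simp)
    · rw [← hd]
      exact lineDeriv_eq_zero_of_notMem_tsupport hx 1
  have e : ∀ n, ∫ x, φ x * deriv (vn n) x =
      (∫ x, φ x * deriv v x) - ∫ x, (vn n x - v x) * deriv φ x := by
    intro n
    simp_rw [sub_mul]
    rw [integral_sub (hint (hvn n)) (hint hv), parts (hvn n), parts hv]
    ring
  simp_rw [e]
  simpa using tendsto_const_nhds.sub h₁

end PlanarJacobian

/-! ### Green's formula on the unit square -/

section Green

/-- The function `g` is constant on each of the half-lines `(-∞, 0]` and `[1, ∞)`. -/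
structure ConstOutsideUnit {Y : Type*} (g : ℝ → Y) : Prop where
  left : ∀ s ≤ 0, g s = g 0
  right : ∀ s, 1 ≤ s → g s = g 1

theorem ConstOutsideUnit.comp {Y Z : Type*} {g : ℝ → Y} (hg : ConstOutsideUnit g) (f : Y → Z) :
    ConstOutsideUnit fun s => f (g s) :=
  ⟨fun s hs => by rw [hg.left s hs], fun s hs => by rw [hg.right s hs]⟩

theorem ConstOutsideUnit.deriv_eq_zero {g : ℝ → ℝ} (hg : ConstOutsideUnit g) {s : ℝ}
    (hs : s ∉ Icc (0 : ℝ) 1) : deriv g s = 0 := by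
  rw [mem_Icc, not_and_or, not_le, not_le] at hs
  rcases hs with hs | hs
  · have : g =ᶠ[𝓝 s] fun _ => g 0 := by
      filter_upwards [Iio_mem_nhds hs] with r hr using hg.left r (le_of_lt hr)
    rw [this.deriv_eq, deriv_const]
  · have : g =ᶠ[𝓝 s] fun _ => g 1 := by
      filter_upwards [Ioi_mem_nhds hs] with r hr using hg.right r (le_of_lt hr)
    rw [this.deriv_eq, deriv_const]

/-- A piecewise affine function with support `[-1, 2]` which equals `1` on `[0, 1]`. -/
noncomputable def unitCutoff (s : ℝ) : ℝ := max 0 (min 1 (min (s + 1) (2 - s)))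

theorem lipschitzWith_unitCutoff : LipschitzWith 1 unitCutoff := by
  have h₁ : LipschitzWith 1 fun s : ℝ => s + 1 := by
    simpa using LipschitzWith.id.add (LipschitzWith.const (1 : ℝ))
  have h₂ : LipschitzWith 1 fun s : ℝ => 2 - s := by
    simpa using (LipschitzWith.const (2 : ℝ)).sub LipschitzWith.id
  have h₃ : LipschitzWith 1 fun s : ℝ => min (s + 1) (2 - s) := by
    simpa using h₁.min h₂
  exact (h₃.const_min 1).const_max 0

theorem unitCutoff_eq_one {s : ℝ} (hs : s ∈ Icc (0 : ℝ) 1) : unitCutoff s = 1 := by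
  have h : 1 ≤ min (s + 1) (2 - s) := le_min (by linarith [hs.1]) (by linarith [hs.2])
  simp [unitCutoff, min_eq_left h]

theorem unitCutoff_eq_zero {s : ℝ} (hs : s ∉ Icc (-1 : ℝ) 2) : unitCutoff s = 0 := by
  rw [mem_Icc, not_and_or, not_le, not_le] at hs
  refine max_eq_left ((min_le_right _ _).trans ?_)
  rcases hs with hs | hs
  · exact (min_le_left _ _).trans (by linarith)
  · exact (min_le_right _ _).trans (by linarith)

theorem hasCompactSupport_unitCutoff : HasCompactSupport unitCutoff :=
  HasCompactSupport.intro isCompact_Icc fun _ => unitCutoff_eq_zero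

theorem deriv_unitCutoff_ae : deriv unitCutoff =ᵐ[volume]
    fun s => (Ioo (-1 : ℝ) 0).indicator 1 s - (Ioo (1 : ℝ) 2).indicator 1 s := by
  have hne : ∀ c : ℝ, ∀ᵐ s : ℝ, s ≠ c := fun c => by simp [ae_iff, measure_singleton]
  filter_upwards [hne (-1), hne 0, hne 1, hne 2] with s h₁ h₂ h₃ h₄
  have loc : ∀ {l r : ℝ} {g : ℝ → ℝ}, s ∈ Ioo l r → (∀ x ∈ Ioo l r, unitCutoff x = g x) →
      deriv unitCutoff s = deriv g s := fun hs h =>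
    Filter.EventuallyEq.deriv_eq (by filter_upwards [Ioo_mem_nhds hs.1 hs.2] with x hx using h x hx)
  rcases lt_or_gt_of_ne h₁ with h | h
  · have hz : s ∈ Ioo (s - 1) (-1) := ⟨by linarith, h⟩
    rw [loc hz (g := fun _ => 0) fun x hx => unitCutoff_eq_zero fun h => by linarith [hx.2, h.1]]
    rw [indicator_of_notMem (fun h' => by linarith [h'.1]),
      indicator_of_notMem (fun h' => by linarith [h'.1])]
    simp
  rcases lt_or_gt_of_ne h₂ with h' | h'
  · rw [loc (l := -1) (r := 0) ⟨h, h'⟩ (g := fun x => x + 1) fun x (hx : x ∈ Ioo (-1) 0) => ?_]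
    · rw [indicator_of_mem (mem_Ioo.mpr ⟨h, h'⟩), indicator_of_notMem (fun h' => by linarith [h'.1])]
      simp
    · have e₁ : min (x + 1) (2 - x) = x + 1 := min_eq_left (by linarith [hx.2])
      have e₂ : min 1 (x + 1) = x + 1 := min_eq_right (by linarith [hx.2])
      rw [unitCutoff, e₁, e₂, max_eq_right (by linarith [hx.1])]
  rcases lt_or_gt_of_ne h₃ with k | k
  · rw [loc ⟨h', k⟩ (g := fun _ => 1) fun x hx => unitCutoff_eq_one ⟨hx.1.le, hx.2.le⟩]
    rw [indicator_of_notMem (fun h => by linarith [h.2]),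
      indicator_of_notMem (fun h => by linarith [h.1])]
    simp
  rcases lt_or_gt_of_ne h₄ with k' | k'
  · rw [loc (l := 1) (r := 2) ⟨k, k'⟩ (g := fun x => 2 - x) fun x (hx : x ∈ Ioo 1 2) => ?_]
    · rw [indicator_of_mem (mem_Ioo.mpr ⟨k, k'⟩), indicator_of_notMem (fun h => by linarith [h.2])]
      simp
    · have e₁ : min (x + 1) (2 - x) = 2 - x := min_eq_right (by linarith [hx.1])
      have e₂ : min 1 (2 - x) = 2 - x := min_eq_right (by linarith [hx.1])
      rw [unitCutoff, e₁, e₂, max_eq_right (by linarith [hx.2])]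
  · have hz : s ∈ Ioo 2 (s + 1) := ⟨k', by linarith⟩
    rw [loc hz (g := fun _ => 0) fun x hx => unitCutoff_eq_zero fun h => by linarith [hx.1, h.2]]
    rw [indicator_of_notMem (fun h' => by linarith [h'.2]),
      indicator_of_notMem (fun h' => by linarith [h'.2])]
    simp

/-- The cutoff rises by one over `[-1, 0]`, where `G = G 0`, and falls by one over `[1, 2]`, where
`G = G 1`. This produces exact boundary values with no limit of cutoffs. -/
theorem integral_deriv_unitCutoff_mul {G : ℝ → ℝ} (hG : ConstOutsideUnit G) :
    ∫ s, deriv unitCutoff s * G s = G 0 - G 1 := by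
  have h : (fun s => deriv unitCutoff s * G s) =ᵐ[volume]
      fun s => (Ioo (-1 : ℝ) 0).indicator (fun _ => G 0) s -
        (Ioo (1 : ℝ) 2).indicator (fun _ => G 1) s := by
    filter_upwards [deriv_unitCutoff_ae] with s hs
    rw [hs, sub_mul]
    congr 1
    · by_cases h : s ∈ Ioo (-1 : ℝ) 0
      · simp [h, hG.left s h.2.le]
      · simp [h]
    · by_cases h : s ∈ Ioo (1 : ℝ) 2
      · simp [h, hG.right s h.1.le]
      · simp [h]
  rw [integral_congr_ae h, integral_sub, integral_indicator_const _ measurableSet_Ioo,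
    integral_indicator_const _ measurableSet_Ioo]
  · norm_num
  all_goals
    rw [integrable_indicator_iff measurableSet_Ioo]
    exact integrableOn_const (by simp)

theorem integral_deriv_unitCutoff_fst_mul {h : ℝ × ℝ → ℝ}
    (hh : ∀ t, ConstOutsideUnit fun s => h (s, t))
    (hint : Integrable fun x : ℝ × ℝ => deriv unitCutoff x.1 * h x) :
    ∫ x : ℝ × ℝ, deriv unitCutoff x.1 * h x = (∫ t, h (0, t)) - ∫ t, h (1, t) := by
  rw [Measure.volume_eq_prod] at hint ⊢
  rw [integral_prod _ hint]
  simp only [integral_const_mul]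
  refine integral_deriv_unitCutoff_mul (G := fun s => ∫ t, h (s, t)) ⟨fun s hs => ?_, fun s hs => ?_⟩
  · congr 1 with t
    exact (hh t).left s hs
  · congr 1 with t
    exact (hh t).right s hs

theorem integral_deriv_unitCutoff_snd_mul {h : ℝ × ℝ → ℝ}
    (hh : ∀ s, ConstOutsideUnit fun t => h (s, t))
    (hint : Integrable fun x : ℝ × ℝ => deriv unitCutoff x.2 * h x) :
    ∫ x : ℝ × ℝ, deriv unitCutoff x.2 * h x = (∫ s, h (s, 0)) - ∫ s, h (s, 1) := by
  have := integral_deriv_unitCutoff_fst_mul (h := fun x => h x.swap) hh hint.swap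
  rw [Measure.volume_eq_prod] at this ⊢
  rw [← integral_prod_swap]
  exact this

/-- The function `u` on the plane factors through the retraction onto the unit square. -/
structure ConstOutsideSquare {Y : Type*} (u : ℝ × ℝ → Y) : Prop where
  fst : ∀ t, ConstOutsideUnit fun s => u (s, t)
  snd : ∀ s, ConstOutsideUnit fun t => u (s, t)

theorem ConstOutsideSquare.comp {Y Z : Type*} {u : ℝ × ℝ → Y} (hu : ConstOutsideSquare u)
    (f : Y → Z) : ConstOutsideSquare fun x => f (u x) :=
  ⟨fun t => (hu.fst t).comp f, fun s => (hu.snd s).comp f⟩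

theorem ConstOutsideSquare.lineDeriv_fst_eq_zero {u : ℝ × ℝ → ℝ} (hu : ConstOutsideSquare u)
    {x : ℝ × ℝ} (hx : x.1 ∉ Icc (0 : ℝ) 1) : lineDeriv ℝ u x (1, 0) = 0 := by
  rw [lineDeriv_prod_one_zero]
  exact (hu.fst x.2).deriv_eq_zero hx

theorem ConstOutsideSquare.lineDeriv_snd_eq_zero {u : ℝ × ℝ → ℝ} (hu : ConstOutsideSquare u)
    {x : ℝ × ℝ} (hx : x.2 ∉ Icc (0 : ℝ) 1) : lineDeriv ℝ u x (0, 1) = 0 := by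
  rw [lineDeriv_prod_zero_one]
  exact (hu.snd x.1).deriv_eq_zero hx

theorem ConstOutsideSquare.planarJacobian_eq_zero {u v : ℝ × ℝ → ℝ} (hu : ConstOutsideSquare u)
    (hv : ConstOutsideSquare v) {x : ℝ × ℝ} (hx : x ∉ Icc (0 : ℝ) 1 ×ˢ Icc (0 : ℝ) 1) :
    planarJacobian u v x = 0 := by
  rw [mem_prod, not_and_or] at hx
  rcases hx with hx | hx
  · simp [planarJacobian, hu.lineDeriv_fst_eq_zero hx, hv.lineDeriv_fst_eq_zero hx]
  · simp [planarJacobian, hu.lineDeriv_snd_eq_zero hx, hv.lineDeriv_snd_eq_zero hx]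

/-- A Lipschitz function with compact support which equals `1` on the unit square. -/
noncomputable def squareCutoff (x : ℝ × ℝ) : ℝ := unitCutoff x.1 * unitCutoff x.2

theorem hasCompactSupport_squareCutoff : HasCompactSupport squareCutoff := by
  refine HasCompactSupport.intro ((isCompact_Icc (a := (-1 : ℝ)) (b := 2)).prod
    (isCompact_Icc (a := (-1 : ℝ)) (b := 2))) fun x hx => ?_
  rw [mem_prod, not_and_or] at hx
  rcases hx with hx | hx <;> simp [squareCutoff, unitCutoff_eq_zero hx]

theorem abs_unitCutoff_le (s : ℝ) : |unitCutoff s| ≤ 1 := by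
  rw [abs_of_nonneg (le_max_left _ _)]
  exact max_le zero_le_one (min_le_left _ _)

theorem lipschitzWith_squareCutoff : LipschitzWith 2 squareCutoff := by
  refine LipschitzWith.of_dist_le_mul fun x y => ?_
  have h₁ : |unitCutoff x.1 - unitCutoff y.1| ≤ dist x y := by
    have := lipschitzWith_unitCutoff.dist_le_mul x.1 y.1
    rw [Real.dist_eq, NNReal.coe_one, one_mul] at this
    exact this.trans (le_max_left _ _)
  have h₂ : |unitCutoff x.2 - unitCutoff y.2| ≤ dist x y := by
    have := lipschitzWith_unitCutoff.dist_le_mul x.2 y.2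
    rw [Real.dist_eq, NNReal.coe_one, one_mul] at this
    exact this.trans (le_max_right _ _)
  calc dist (squareCutoff x) (squareCutoff y)
      = |(unitCutoff x.1 - unitCutoff y.1) * unitCutoff x.2 +
          unitCutoff y.1 * (unitCutoff x.2 - unitCutoff y.2)| := by
        rw [Real.dist_eq, squareCutoff, squareCutoff]; ring_nf
    _ ≤ |unitCutoff x.1 - unitCutoff y.1| * |unitCutoff x.2| +
          |unitCutoff y.1| * |unitCutoff x.2 - unitCutoff y.2| := by
        rw [← abs_mul, ← abs_mul]; exact abs_add_le _ _
    _ ≤ dist x y * 1 + 1 * dist x y := by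
        gcongr <;> exact abs_unitCutoff_le _
    _ = _ := by push_cast; ring

/-- Off the square the Jacobian vanishes and on it the cutoff is 1, so the compactly supported
theory applies to functions without compact support. -/
theorem squareCutoff_mul_planarJacobian {u v : ℝ × ℝ → ℝ} (hu : ConstOutsideSquare u)
    (hv : ConstOutsideSquare v) (x : ℝ × ℝ) :
    squareCutoff x * planarJacobian u v x = planarJacobian u v x := by
  by_cases hx : x ∈ Icc (0 : ℝ) 1 ×ˢ Icc (0 : ℝ) 1
  · simp [squareCutoff, unitCutoff_eq_one hx.1, unitCutoff_eq_one hx.2]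
  · simp [hu.planarJacobian_eq_zero hv hx]

theorem integrable_planarJacobian {u v : ℝ × ℝ → ℝ} {C D : ℝ≥0} (hu : ConstOutsideSquare u)
    (hv : ConstOutsideSquare v) (hul : LipschitzWith C u) (hvl : LipschitzWith D v) :
    Integrable (planarJacobian u v) := by
  have := integrable_mul_planarJacobian lipschitzWith_squareCutoff.continuous
    hasCompactSupport_squareCutoff hul hvl
  simpa only [squareCutoff_mul_planarJacobian hu hv] using this

/-- Green's formula on the unit square for Lipschitz functions. -/
theorem integral_planarJacobian_eq_boundary {u v : ℝ × ℝ → ℝ} {C D : ℝ≥0}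
    (hu : ConstOutsideSquare u) (hv : ConstOutsideSquare v) (hul : LipschitzWith C u)
    (hvl : LipschitzWith D v) :
    ∫ x, planarJacobian u v x =
      (∫ s, u (s, 0) * deriv (fun r => v (r, 0)) s) - (∫ s, u (s, 1) * deriv (fun r => v (r, 1)) s) +
      ((∫ t, u (1, t) * deriv (fun r => v (1, r)) t) -
        ∫ t, u (0, t) * deriv (fun r => v (0, r)) t) := by
  have hcut : ∀ (p : ℝ × ℝ → ℝ), ConstOutsideSquare p → ∀ x : ℝ × ℝ,
      unitCutoff x.1 * lineDeriv ℝ p x (1, 0) = lineDeriv ℝ p x (1, 0) ∧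
      unitCutoff x.2 * lineDeriv ℝ p x (0, 1) = lineDeriv ℝ p x (0, 1) := by
    intro p hp x
    constructor
    · by_cases hx : x.1 ∈ Icc (0 : ℝ) 1
      · rw [unitCutoff_eq_one hx, one_mul]
      · rw [hp.lineDeriv_fst_eq_zero hx, mul_zero]
    · by_cases hx : x.2 ∈ Icc (0 : ℝ) 1
      · rw [unitCutoff_eq_one hx, one_mul]
      · rw [hp.lineDeriv_snd_eq_zero hx, mul_zero]
  -- In each term the undifferentiated cutoff factor can be dropped, since the partial derivative of
  -- `v` in that variable vanishes where the factor differs from 1.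
  have hjac : ∀ x, u x * planarJacobian squareCutoff v x =
      deriv unitCutoff x.1 * (u x * lineDeriv ℝ v x (0, 1)) -
        deriv unitCutoff x.2 * (u x * lineDeriv ℝ v x (1, 0)) := by
    intro x
    have e₁ : lineDeriv ℝ squareCutoff x (1, 0) = deriv unitCutoff x.1 * unitCutoff x.2 := by
      rw [lineDeriv_prod_one_zero]
      simp only [squareCutoff, deriv_mul_const_field]
    have e₂ : lineDeriv ℝ squareCutoff x (0, 1) = unitCutoff x.1 * deriv unitCutoff x.2 := by
      rw [lineDeriv_prod_zero_one]
      simp only [squareCutoff, deriv_const_mul_field]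
    rw [planarJacobian, e₁, e₂]
    linear_combination (u x * deriv unitCutoff x.1) * (hcut v hv x).2 -
      (u x * deriv unitCutoff x.2) * (hcut v hv x).1
  have hderiv : ∀ s, |deriv unitCutoff s| ≤ 1 := fun s => by
    simpa using norm_deriv_le_of_lipschitz lipschitzWith_unitCutoff (x₀ := s)
  have hderiv0 : ∀ s ∉ Icc (-1 : ℝ) 2, deriv unitCutoff s = 0 := by
    intro s hs
    have : unitCutoff =ᶠ[𝓝 s] fun _ => 0 := by
      filter_upwards [isClosed_Icc.isOpen_compl.mem_nhds hs] with r hr using unitCutoff_eq_zero hr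
    rw [this.deriv_eq, deriv_const]
  have hm : Measurable (deriv unitCutoff) := measurable_deriv _
  have hK : IsCompact (Icc (-1 : ℝ) 2 ×ˢ Icc (-1 : ℝ) 2) := isCompact_Icc.prod isCompact_Icc
  have hsub : ∀ {r : ℝ}, r ∈ Icc (0 : ℝ) 1 → r ∈ Icc (-1 : ℝ) 2 := fun h =>
    ⟨by linarith [h.1], by linarith [h.2]⟩
  have int₁ : Integrable fun x : ℝ × ℝ =>
      deriv unitCutoff x.1 * (u x * lineDeriv ℝ v x (0, 1)) := by
    rw [← integrableOn_iff_integrable_of_support_subset (s := Icc (-1 : ℝ) 2 ×ˢ Icc (-1 : ℝ) 2)]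
    · refine Integrable.bdd_mul (c := 1) (Integrable.mul_bdd (c := D)
        (hul.continuous.continuousOn.integrableOn_compact hK)
        (aestronglyMeasurable_lineDeriv hvl.continuous _)
        (.of_forall fun x => hvl.abs_lineDeriv_le x (by simp [Prod.norm_def])))
        (hm.comp measurable_fst).aestronglyMeasurable (.of_forall fun x => hderiv _)
    · intro x hx
      by_contra h
      rw [mem_prod, not_and_or] at h
      refine hx ?_
      rcases h with h | h
      · simp [hderiv0 _ h]
      · simp [hv.lineDeriv_snd_eq_zero fun h' => h (hsub h')]
  have int₂ : Integrable fun x : ℝ × ℝ =>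
      deriv unitCutoff x.2 * (u x * lineDeriv ℝ v x (1, 0)) := by
    rw [← integrableOn_iff_integrable_of_support_subset (s := Icc (-1 : ℝ) 2 ×ˢ Icc (-1 : ℝ) 2)]
    · refine Integrable.bdd_mul (c := 1) (Integrable.mul_bdd (c := D)
        (hul.continuous.continuousOn.integrableOn_compact hK)
        (aestronglyMeasurable_lineDeriv hvl.continuous _)
        (.of_forall fun x => hvl.abs_lineDeriv_le x (by simp [Prod.norm_def])))
        (hm.comp measurable_snd).aestronglyMeasurable (.of_forall fun x => hderiv _)
    · intro x hx
      by_contra h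
      rw [mem_prod, not_and_or] at h
      refine hx ?_
      rcases h with h | h
      · simp [hv.lineDeriv_fst_eq_zero fun h' => h (hsub h')]
      · simp [hderiv0 _ h]
  -- All derivatives of `u` fall on the cutoff. Its `s`-derivative yields the edges `s = 0, 1`, its
  -- `t`-derivative the edges `t = 0, 1`.
  have main := integral_mul_planarJacobian lipschitzWith_squareCutoff
    hasCompactSupport_squareCutoff hul hvl
  simp only [squareCutoff_mul_planarJacobian hu hv, hjac] at main
  rw [main, integral_sub int₁ int₂, integral_deriv_unitCutoff_fst_mul _ int₁,
    integral_deriv_unitCutoff_snd_mul _ int₂]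
  · simp only [lineDeriv_prod_one_zero, lineDeriv_prod_zero_one]
    ring
  · intro s
    simp only [lineDeriv_prod_one_zero]
    exact ⟨fun t ht => by simp only [(hu.snd _).left t ht, (hv.snd _).left t ht],
      fun t ht => by simp only [(hu.snd _).right t ht, (hv.snd _).right t ht]⟩
  · intro t
    simp only [lineDeriv_prod_zero_one]
    exact ⟨fun s hs => by simp only [(hu.fst _).left s hs, (hv.fst _).left s hs],
      fun s hs => by simp only [(hu.fst _).right s hs, (hv.fst _).right s hs]⟩

end Green

/-! ### The optimal Lipschitz constant -/

section LipConst

variable {X : Type*} [MetricSpace X]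

theorem lipConst_nonneg (π : LipFun X) : 0 ≤ lipConst π :=
  Real.iSup_nonneg fun _ => by positivity

theorem abs_sub_le_lipConst_mul (π : LipFun X) (x y : X) :
    |π.1 x - π.1 y| ≤ lipConst π * dist x y := by
  obtain ⟨K, hK⟩ := π.2
  rcases eq_or_ne x y with rfl | hxy
  · simp
  rw [← div_le_iff₀ (dist_pos.mpr hxy)]
  refine le_ciSup (f := fun p : X × X => |π.1 p.1 - π.1 p.2| / dist p.1 p.2) ⟨K, ?_⟩ (x, y)
  rintro _ ⟨⟨p, q⟩, rfl⟩
  exact div_le_of_le_mul₀ dist_nonneg K.2 (hK.dist_le_mul p q)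

theorem lipschitzWith_of_lipConst_le {π : LipFun X} {C : ℝ} (h : lipConst π ≤ C) :
    LipschitzWith C.toNNReal π.1 := by
  refine LipschitzWith.of_dist_le_mul fun x y => ?_
  rw [Real.dist_eq, Real.coe_toNNReal _ ((lipConst_nonneg π).trans h)]
  exact (abs_sub_le_lipConst_mul π x y).trans (by gcongr)

theorem lipschitzWith_lipConst (π : LipFun X) : LipschitzWith (lipConst π).toNNReal π.1 :=
  lipschitzWith_of_lipConst_le le_rfl

theorem BddLipFun.continuous (f : BddLipFun X) : Continuous f.1 :=
  f.2.1.choose_spec.continuous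

theorem BddLipFun.integrable [MeasurableSpace X] [BorelSpace X] (f : BddLipFun X) (μ : Measure X)
    [IsFiniteMeasure μ] : Integrable f.1 μ := by
  obtain ⟨C, hC⟩ := f.2.2
  exact Integrable.of_bound (BddLipFun.continuous f).measurable.aestronglyMeasurable C
    (.of_forall fun x => hC x)

end LipConst

/-! ### Algebra of currents, mass and flat norm -/

section Currents

variable {X : Type*} [MetricSpace X] {k : ℕ}

theorem isMultilinear_of_forall {T : Functional X k}
    (f_add : ∀ f g π, T (f + g) π = T f π + T g π)
    (f_smul : ∀ (c : ℝ) f π, T (c • f) π = c * T f π)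
    (π_add : ∀ f π i p q, T f (Function.update π i (p + q)) =
      T f (Function.update π i p) + T f (Function.update π i q))
    (π_smul : ∀ f π i (c : ℝ) p, T f (Function.update π i (c • p)) =
      c * T f (Function.update π i p)) : IsMultilinear T := by
  refine ⟨⟨⟨fun f => ⟨T f, ?_, ?_⟩, fun f g => ?_⟩, fun c f => ?_⟩, fun f π => rfl⟩
  · intro inst π i p q
    -- The fields of `MultilinearMap` quantify over all decidability instances, the hypotheses use
    -- the canonical one.
    rw [Subsingleton.elim inst (instDecidableEqFin k)]
    exact π_add f π i p q
  · intro inst π i c p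
    rw [Subsingleton.elim inst (instDecidableEqFin k)]
    exact π_smul f π i c p
  · ext π
    exact f_add f g π
  · ext π
    exact f_smul c f π

theorem IsMultilinear.sub {T T' : Functional X k} (h : IsMultilinear T) (h' : IsMultilinear T') :
    IsMultilinear (T - T') := by
  obtain ⟨M, hM⟩ := h
  obtain ⟨M', hM'⟩ := h'
  exact ⟨M - M', fun f π => by simp [hM, hM']⟩

theorem IsMultilinear.apply_sub {T : Functional X k} (h : IsMultilinear T) (f g : BddLipFun X)
    (π : Fin k → LipFun X) : T (f - g) π = T f π - T g π := by
  obtain ⟨M, hM⟩ := h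
  simp [hM]

variable [MeasurableSpace X]

/-- Any bounding measure lies above the infimum, so mass estimates never require identifying `‖T‖`.
-/
theorem mass_le_of_massBound {T : Functional X k} {μ : Measure X} (h : MassBound T μ) :
    mass T ≤ μ univ :=
  Measure.le_iff'.mp (sInf_le h) univ

theorem flatNorm_le {T R : Functional X k} {S : Functional X (k + 1)} (hS : IsNormalCurrent S)
    (hR : IsMetricCurrent R) (hT : T = boundary S + R) : flatNorm T ≤ mass S + mass R :=
  iInf_le_of_le S (iInf_le_of_le R (iInf_le _ ⟨hS, hR, hT⟩))

variable [BorelSpace X]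

theorem MassBound.sub {T T' : Functional X k} {μ μ' : Measure X} (h : MassBound T μ)
    (h' : MassBound T' μ') : MassBound (T - T') (μ + μ') := by
  have := h.1
  have := h'.1
  refine ⟨inferInstance, fun f π => ?_⟩
  rw [integral_add_measure (BddLipFun.integrable f μ).abs (BddLipFun.integrable f μ').abs, mul_add]
  exact (abs_sub _ _).trans (add_le_add (h.2 f π) (h'.2 f π))

theorem IsMetricCurrent.sub {T T' : Functional X k} (h : IsMetricCurrent T)
    (h' : IsMetricCurrent T') : IsMetricCurrent (T - T') where
  multilinear := h.multilinear.sub h'.multilinear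
  locality f π hi := by simp [h.locality f π hi, h'.locality f π hi]
  joint_continuity f πs π hC hlim :=
    (h.joint_continuity f πs π hC hlim).sub (h'.joint_continuity f πs π hC hlim)
  finite_mass := by
    obtain ⟨μ, hμ⟩ := h.finite_mass
    obtain ⟨μ', hμ'⟩ := h'.finite_mass
    exact ⟨μ + μ', hμ.sub hμ'⟩

end Currents

/-! ### Density of Lipschitz functions and the Borel extension -/

section Density

variable {X : Type*} [MetricSpace X] [MeasurableSpace X] [BorelSpace X]

/-- Bounded Lipschitz functions are dense in `L¹` of a finite Borel measure. -/
theorem exists_bddLipFun_tendsto_lintegral (μ : Measure X) [IsFiniteMeasure μ] {f : X → ℝ}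
    (hf : Measurable f) (hb : ∃ C : ℝ, ∀ x, |f x| ≤ C) :
    ∃ u : ℕ → BddLipFun X, Tendsto (fun n => ∫⁻ x, ‖(u n).1 x - f x‖ₑ ∂μ) atTop (𝓝 0) := by
  obtain ⟨C, hC⟩ := hb
  have hmem : MemLp f 1 μ :=
    memLp_one_iff_integrable.mpr (Integrable.of_bound hf.aestronglyMeasurable C (.of_forall hC))
  have dense : ∀ ε : ℝ≥0∞, ε ≠ 0 → ∃ g : X → ℝ, eLpNorm (f - g) 1 μ ≤ ε ∧ g ∈ BddLipFun X := by
    intro ε hε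
    refine hmem.induction_dense ENNReal.one_ne_top (fun g => g ∈ BddLipFun X) ?_
      (fun g g' => Submodule.add_mem _)
      (fun g hg => (BddLipFun.continuous ⟨g, hg⟩).measurable.aestronglyMeasurable) hε
    intro c s hs _ ε hε
    -- For `c = 0` this is `⊤`, which is harmless because `‖c‖ₑ * δ ≤ ε` still holds.
    set δ : ℝ≥0∞ := ε / ‖c‖ₑ
    have hδ : δ ≠ 0 := by simp [δ, hε]
    have hδ2 : δ / 2 ≠ 0 := by simp [hδ]
    -- Half of the error pays for replacing `s` by a closed subset, the other half for replacing the
    -- indicator of that subset by a Lipschitz thickened indicator.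
    obtain ⟨F, hFs, hF, hFδ⟩ := hs.exists_isClosed_sdiff_lt (measure_ne_top μ s) hδ2
    have hpos : ∀ n : ℕ, (0 : ℝ) < 1 / (n + 1) := fun n => by positivity
    set h : ℕ → X → ℝ := fun n x => (thickenedIndicator (hpos n) F x : ℝ)
    have hc : ∀ n, Continuous (h n) := fun n =>
      NNReal.continuous_coe.comp (thickenedIndicator (hpos n) F).continuous
    have hle : ∀ n x, |h n x| ≤ 1 := fun n x => by
      rw [abs_of_nonneg (NNReal.coe_nonneg _)]
      exact_mod_cast thickenedIndicator_le_one (hpos n) F x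
    have hlim : Tendsto (fun n => ∫⁻ x, ‖h n x - F.indicator 1 x‖ₑ ∂μ) atTop (𝓝 0) := by
      have hpt := thickenedIndicator_tendsto_indicator_closure hpos
        tendsto_one_div_add_atTop_nhds_zero_nat F
      rw [hF.closure_eq, tendsto_pi_nhds] at hpt
      rw [show (0 : ℝ≥0∞) = ∫⁻ _, 0 ∂μ by simp]
      refine tendsto_lintegral_of_dominated_convergence (fun _ => 2) (fun n => ?_) (fun n => ?_)
        (by simpa using ENNReal.mul_ne_top (by simp) (measure_ne_top μ univ)) ?_
      · exact ((hc n).measurable.sub (measurable_one.indicator hF.measurableSet)).enorm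
      · refine .of_forall fun x => ?_
        have : ‖h n x - F.indicator 1 x‖ ≤ 2 := by
          refine (abs_sub _ _).trans ?_
          have : |F.indicator (1 : X → ℝ) x| ≤ 1 := by
            by_cases hx : x ∈ F <;> simp [hx]
          linarith [hle n x]
        beta_reduce
        rw [← ofReal_norm]
        simpa using ENNReal.ofReal_le_ofReal this
      · refine .of_forall fun x => ?_
        have h1 : Tendsto (fun n => h n x) atTop (𝓝 (F.indicator 1 x)) := by
          have := NNReal.tendsto_coe.mpr (hpt x)
          convert! this using 2
          by_cases hx : x ∈ F <;> simp [hx]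
        have h2 := (h1.sub_const (F.indicator 1 x)).enorm
        simpa using h2
    obtain ⟨n, hn⟩ := (hlim.eventually_lt_const (pos_iff_ne_zero.mpr hδ2)).exists
    refine ⟨fun x => c * h n x, ?_, Submodule.smul_mem _ c ⟨?_, 1, hle n⟩⟩
    · rw [eLpNorm_one_eq_lintegral_enorm]
      calc ∫⁻ x, ‖((fun x => c * h n x) - s.indicator fun _ => c) x‖ₑ ∂μ
          ≤ ∫⁻ x, ‖c‖ₑ * (‖h n x - F.indicator 1 x‖ₑ + (s \ F).indicator 1 x) ∂μ := by
            refine lintegral_mono fun x => ?_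
            by_cases hxF : x ∈ F
            · have hxs := hFs hxF
              simp only [Pi.sub_apply, hxs, hxF, indicator_of_mem, Pi.one_apply, Set.mem_sdiff,
                not_true_eq_false, and_false, not_false_eq_true, indicator_of_notMem, add_zero]
              rw [← enorm_mul, mul_sub, mul_one]
            by_cases hxs : x ∈ s
            · simp only [Pi.sub_apply, hxs, hxF, indicator_of_mem, Pi.one_apply, Set.mem_sdiff,
                not_false_eq_true, and_true, indicator_of_notMem, sub_zero]
              calc ‖c * h n x - c‖ₑ = ‖c‖ₑ * ‖h n x - 1‖ₑ := by
                    rw [← enorm_mul, mul_sub, mul_one]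
                _ ≤ ‖c‖ₑ * (‖h n x‖ₑ + 1) := by
                    gcongr
                    simpa using enorm_sub_le (a := h n x) (b := (1 : ℝ))
            · simp [hxs, hxF]
        _ = ‖c‖ₑ * (∫⁻ x, ‖h n x - F.indicator 1 x‖ₑ ∂μ + μ (s \ F)) := by
            rw [lintegral_const_mul' _ _ (by simp), lintegral_add_right _
              (measurable_one.indicator (hs.diff hF.measurableSet)),
              lintegral_indicator_one (hs.diff hF.measurableSet)]
        _ ≤ ‖c‖ₑ * (δ / 2 + δ / 2) := by gcongr
        _ = ‖c‖ₑ * δ := by rw [ENNReal.add_halves]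
        _ ≤ ε := ENNReal.mul_div_le
    · exact ⟨_, NNReal.isometry_coe.lipschitz.comp (lipschitzWith_thickenedIndicator (hpos n) F)⟩
  choose g hg hgm using fun n : ℕ => dense ((n : ℝ≥0∞) + 1)⁻¹ (ENNReal.inv_ne_zero.mpr (by finiteness))
  refine ⟨fun n => ⟨g n, hgm n⟩, tendsto_of_tendsto_of_tendsto_of_le_of_le tendsto_const_nhds
    (h := fun n : ℕ => ((n : ℝ≥0∞) + 1)⁻¹) ?_ (fun _ => zero_le) fun n => ?_⟩
  · have := (tendsto_add_atTop_iff_nat 1).mpr ENNReal.tendsto_inv_nat_nhds_zero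
    simpa using this
  · refine le_trans (le_of_eq ?_) (hg n)
    rw [eLpNorm_one_eq_lintegral_enorm]
    congr 1 with x
    exact enorm_sub_rev _ _

variable {k : ℕ}

/-- If `T(·, π)` is the restriction to bounded Lipschitz functions of a functional on bounded Borel
functions which is continuous in `L¹(ν)`, then that functional is the canonical extension. -/
theorem borelExt_eq {T : Functional X k} (hmul : IsMultilinear T) (hmass : ∃ μ, MassBound T μ)
    {π : Fin k → LipFun X} {B : (X → ℝ) → ℝ} {ν : Measure X} [IsFiniteMeasure ν]
    (hB : ∀ f g : X → ℝ, Measurable f → Measurable g → (∃ C : ℝ, ∀ x, |f x| ≤ C) →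
      (∃ C : ℝ, ∀ x, |g x| ≤ C) → ‖B f - B g‖ₑ ≤ ∫⁻ x, ‖f x - g x‖ₑ ∂ν)
    (hTB : ∀ u : BddLipFun X, T u π = B u.1) {f : X → ℝ} (hf : Measurable f)
    (hb : ∃ C : ℝ, ∀ x, |f x| ≤ C) : borelExt T f π = B f := by
  -- Approximating in `L¹(μ + ν)` serves both the definition of the extension, through `μ`, and the
  -- continuity of `B`, through `ν`.
  have approx : ∀ μ : Measure X, IsFiniteMeasure μ → ∃ w : ℕ → BddLipFun X,
      Tendsto (fun n => ∫⁻ x, ‖(w n).1 x - f x‖ₑ ∂μ) atTop (𝓝 0) ∧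
      Tendsto (fun n => T (w n) π) atTop (𝓝 (B f)) := by
    intro μ _
    obtain ⟨w, hw⟩ := exists_bddLipFun_tendsto_lintegral (μ + ν) hf hb
    have hle : ∀ ρ : Measure X, ρ ≤ μ + ν →
        Tendsto (fun n => ∫⁻ x, ‖(w n).1 x - f x‖ₑ ∂ρ) atTop (𝓝 0) := fun ρ hρ =>
      tendsto_of_tendsto_of_tendsto_of_le_of_le tendsto_const_nhds hw (fun _ => zero_le)
        fun n => lintegral_mono' hρ le_rfl
    refine ⟨w, hle μ (Measure.le_add_right le_rfl), ?_⟩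
    rw [tendsto_iff_edist_tendsto_0]
    refine tendsto_of_tendsto_of_tendsto_of_le_of_le tendsto_const_nhds
      (hle ν (Measure.le_add_left le_rfl)) (fun _ => zero_le) fun n => ?_
    rw [hTB, edist_eq_enorm_sub]
    exact hB _ _ (BddLipFun.continuous (w n)).measurable hf (w n).2.2 hb
  -- The given sequence `u` converges only in `L¹(μ)`, where `B` is not controlled. It is compared
  -- with `w` through the mass bound of `T`.
  have unique : ∀ a, IsBorelExtValue T f π a → a = B f := by
    rintro a ⟨μ, hμ, u, hu, hua⟩
    obtain ⟨w, hw, hwB⟩ := approx μ hμ.1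
    have := hμ.1
    refine tendsto_nhds_unique hua ?_
    set C := ∏ i, lipConst (π i)
    have hC : 0 ≤ C := Finset.prod_nonneg fun i _ => lipConst_nonneg _
    have hdiff : Tendsto (fun n => T (u n) π - T (w n) π) atTop (𝓝 0) := by
      rw [tendsto_zero_iff_enorm_tendsto_zero]
      have hsum : Tendsto (fun n => ENNReal.ofReal C * (∫⁻ x, ‖(u n).1 x - f x‖ₑ ∂μ +
          ∫⁻ x, ‖(w n).1 x - f x‖ₑ ∂μ)) atTop (𝓝 0) := by
        simpa using ENNReal.Tendsto.const_mul (hu.add hw) (Or.inr ENNReal.ofReal_ne_top)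
      refine tendsto_of_tendsto_of_tendsto_of_le_of_le tendsto_const_nhds hsum
        (fun _ => zero_le) fun n => ?_
      rw [← hmul.apply_sub]
      calc ‖T (u n - w n) π‖ₑ = ENNReal.ofReal |T (u n - w n) π| :=
            (ofReal_norm _).symm
        _ ≤ ENNReal.ofReal (C * ∫ x, |(u n - w n).1 x| ∂μ) :=
            ENNReal.ofReal_le_ofReal (hμ.2 _ _)
        _ = ENNReal.ofReal C * ∫⁻ x, ‖(u n - w n).1 x‖ₑ ∂μ := by
            rw [ENNReal.ofReal_mul hC]
            congr 1
            exact ofReal_integral_norm_eq_lintegral_enorm (BddLipFun.integrable (u n - w n) μ)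
        _ ≤ _ := by
            gcongr
            have hm : Measurable fun x => ‖(u n).1 x - f x‖ₑ :=
              ((BddLipFun.continuous (u n)).measurable.sub hf).enorm
            rw [← lintegral_add_left hm]
            refine lintegral_mono fun x => ?_
            have : (u n - w n).1 x = ((u n).1 x - f x) - ((w n).1 x - f x) := by
              change (u n).1 x - (w n).1 x = _
              ring
            rw [this]
            exact enorm_sub_le
    simpa using hdiff.add hwB
  have exist : ∃ a, IsBorelExtValue T f π a := by
    obtain ⟨μ, hμ⟩ := hmass
    obtain ⟨w, hw, hwB⟩ := approx μ hμ.1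
    exact ⟨B f, μ, hμ, w, hw, hwB⟩
  rw [borelExt, dif_pos exist]
  exact unique _ exist.choose_spec

end Density

/-! ### Currents given by integration against densities -/

section DensityFunctional

variable {X Ω : Type*} [MetricSpace X] [MeasurableSpace Ω] {k : ℕ}

/-- The functional `(f, π) ↦ ∫ f(F(x)) D_π(x) dP(x)`. -/
noncomputable def densityFunctional (P : Measure Ω) (F : Ω → X)
    (D : (Fin k → LipFun X) → Ω → ℝ) : Functional X k :=
  fun f π => ∫ x, f.1 (F x) * D π x ∂P

/-- The densities `D_π` are multilinear and local in `π`, and they are bounded by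
`∏ᵢ LIP(πᵢ) ρ`. -/
structure IsCurrentDensity [MeasurableSpace X] (P : Measure Ω) (F : Ω → X)
    (D : (Fin k → LipFun X) → Ω → ℝ) (ρ : Ω → ℝ) : Prop where
  measurable_map : Measurable F
  integrable : ∀ π, Integrable (D π) P
  integrable_bound : Integrable ρ P
  bound_nonneg : ∀ x, 0 ≤ ρ x
  add : ∀ π i p q, D (Function.update π i (p + q)) =ᵐ[P]
    fun x => D (Function.update π i p) x + D (Function.update π i q) x
  smul : ∀ π i (c : ℝ) p, D (Function.update π i (c • p)) =ᵐ[P]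
    fun x => c * D (Function.update π i p) x
  bound : ∀ π, ∀ᵐ x ∂P, |D π x| ≤ (∏ i, lipConst (π i)) * ρ x
  locality : ∀ π i (c : ℝ) (U : Set X), IsOpen U → (∀ y ∈ U, (π i).1 y = c) →
    ∀ x, F x ∈ U → D π x = 0

namespace IsCurrentDensity

variable [MeasurableSpace X] {P : Measure Ω} {F : Ω → X}
  {D : (Fin k → LipFun X) → Ω → ℝ} {ρ : Ω → ℝ}

theorem integrable_comp_mul (h : IsCurrentDensity P F D ρ) {f : X → ℝ} (hf : Measurable f)
    (hb : ∃ C : ℝ, ∀ x, |f x| ≤ C) {d : Ω → ℝ} (hd : Integrable d P) :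
    Integrable (fun x => f (F x) * d x) P := by
  obtain ⟨C, hC⟩ := hb
  exact hd.bdd_mul (c := C) (hf.comp h.measurable_map).aestronglyMeasurable
    (.of_forall fun x => hC _)

theorem isFiniteMeasure_map (h : IsCurrentDensity P F D ρ) (π : Fin k → LipFun X) :
    IsFiniteMeasure ((P.withDensity fun x => ‖D π x‖ₑ).map F) := by
  have : IsFiniteMeasure (P.withDensity fun x => ‖D π x‖ₑ) :=
    isFiniteMeasure_withDensity (h.integrable π).2.ne
  infer_instance

theorem map_withDensity_univ (h : IsCurrentDensity P F D ρ) :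
    (P.withDensity fun x => ENNReal.ofReal (ρ x)).map F univ =
      ∫⁻ x, ENNReal.ofReal (ρ x) ∂P := by
  rw [Measure.map_apply h.measurable_map MeasurableSet.univ, preimage_univ,
    withDensity_apply _ MeasurableSet.univ, Measure.restrict_univ]

/-- The finite measure `F_#(|D_π| P)` dominates the action of the current on functions. -/
theorem enorm_integral_sub_le (h : IsCurrentDensity P F D ρ) (π : Fin k → LipFun X)
    {f g : X → ℝ} (hf : Measurable f) (hg : Measurable g) (hfb : ∃ C : ℝ, ∀ x, |f x| ≤ C)
    (hgb : ∃ C : ℝ, ∀ x, |g x| ≤ C) :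
    ‖∫ x, f (F x) * D π x ∂P - ∫ x, g (F x) * D π x ∂P‖ₑ ≤
      ∫⁻ y, ‖f y - g y‖ₑ ∂((P.withDensity fun x => ‖D π x‖ₑ).map F) := by
  have hm : Measurable fun y => ‖f y - g y‖ₑ := (hf.sub hg).enorm
  rw [← integral_sub (h.integrable_comp_mul hf hfb (h.integrable π))
    (h.integrable_comp_mul hg hgb (h.integrable π)), lintegral_map hm h.measurable_map,
    lintegral_withDensity_eq_lintegral_mul₀ (g := fun x => ‖f (F x) - g (F x)‖ₑ)
      (h.integrable π).aestronglyMeasurable.enorm (hm.comp h.measurable_map).aemeasurable]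
  refine (enorm_integral_le_lintegral_enorm _).trans (le_of_eq ?_)
  congr 1 with x
  rw [← sub_mul, enorm_mul, mul_comm]
  rfl

variable [BorelSpace X]

theorem isMultilinear (h : IsCurrentDensity P F D ρ) :
    IsMultilinear (densityFunctional P F D) := by
  have hI : ∀ (f : BddLipFun X) π, Integrable (fun x => f.1 (F x) * D π x) P := fun f π =>
    h.integrable_comp_mul (BddLipFun.continuous f).measurable f.2.2 (h.integrable π)
  refine isMultilinear_of_forall (fun f g π => ?_) (fun c f π => ?_) (fun f π i p q => ?_)
    fun f π i c p => ?_
  · simp only [densityFunctional]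
    rw [← integral_add (hI f π) (hI g π)]
    congr 1 with x
    exact add_mul _ _ _
  · simp only [densityFunctional]
    rw [← integral_const_mul]
    congr 1 with x
    exact mul_assoc _ _ _
  · simp only [densityFunctional]
    rw [← integral_add (hI f _) (hI f _)]
    refine integral_congr_ae ?_
    filter_upwards [h.add π i p q] with x hx
    rw [hx, mul_add]
  · simp only [densityFunctional]
    rw [← integral_const_mul]
    refine integral_congr_ae ?_
    filter_upwards [h.smul π i c p] with x hx
    rw [hx]
    ring

theorem massBound (h : IsCurrentDensity P F D ρ) :
    MassBound (densityFunctional P F D)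
      ((P.withDensity fun x => ENNReal.ofReal (ρ x)).map F) := by
  have hfin : IsFiniteMeasure (P.withDensity fun x => ENNReal.ofReal (ρ x)) :=
    isFiniteMeasure_withDensity_ofReal h.integrable_bound.2
  refine ⟨inferInstance, fun f π => ?_⟩
  have hfm : Measurable fun y => |f.1 y| := (BddLipFun.continuous f).abs.measurable
  have hfb : ∃ C : ℝ, ∀ y, |(|f.1 y|)| ≤ C := by simpa using f.2.2
  rw [integral_map h.measurable_map.aemeasurable hfm.aestronglyMeasurable,
    integral_withDensity_eq_integral_toReal_smul₀
      h.integrable_bound.aestronglyMeasurable.aemeasurable.ennreal_ofReal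
      (.of_forall fun _ => ENNReal.ofReal_lt_top), ← integral_const_mul]
  refine (abs_integral_le_integral_abs).trans (integral_mono_ae ?_ ?_ ?_)
  · exact (h.integrable_comp_mul (BddLipFun.continuous f).measurable f.2.2 (h.integrable π)).abs
  · refine Integrable.const_mul ?_ _
    have := h.integrable_comp_mul hfm hfb h.integrable_bound
    simpa only [ENNReal.toReal_ofReal (h.bound_nonneg _), smul_eq_mul, mul_comm (ρ _)] using this
  · filter_upwards [h.bound π] with x hx
    rw [abs_mul, ENNReal.toReal_ofReal (h.bound_nonneg x), smul_eq_mul]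
    calc |f.1 (F x)| * |D π x| ≤ |f.1 (F x)| * ((∏ i, lipConst (π i)) * ρ x) := by gcongr
      _ = _ := by ring

/-- Joint continuity is an assumption because it does not follow from bounds on the densities; it
comes from weak continuity of derivatives or Jacobians in each application. -/
theorem isMetricCurrent (h : IsCurrentDensity P F D ρ)
    (hc : ∀ (f : BddLipFun X) (πs : ℕ → Fin k → LipFun X) (π : Fin k → LipFun X),
      (∃ C : ℝ, ∀ n i, lipConst (πs n i) ≤ C) →
      (∀ i x, Tendsto (fun n => (πs n i).1 x) atTop (𝓝 ((π i).1 x))) →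
      Tendsto (fun n => densityFunctional P F D f (πs n)) atTop
        (𝓝 (densityFunctional P F D f π))) :
    IsMetricCurrent (densityFunctional P F D) where
  multilinear := h.isMultilinear
  locality := by
    rintro f π ⟨i, c, U, hU, hfU, hc⟩
    have : ∀ x, f.1 (F x) * D π x = 0 := fun x => by
      by_cases hx : f.1 (F x) = 0
      · rw [hx, zero_mul]
      · rw [h.locality π i c U hU hc x (hfU hx), mul_zero]
    simp [densityFunctional, this]
  joint_continuity := hc
  finite_mass := ⟨_, h.massBound⟩

theorem mass_le (h : IsCurrentDensity P F D ρ) :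
    mass (densityFunctional P F D) ≤ ∫⁻ x, ENNReal.ofReal (ρ x) ∂P :=
  (mass_le_of_massBound h.massBound).trans_eq h.map_withDensity_univ

/-- The integral formula is continuous in `L¹(F_#(|D_π| P))`, hence survives the extension.
Measurability in the curves becomes a question about explicit integrals. -/
theorem borelExt_eq (h : IsCurrentDensity P F D ρ) (π : Fin k → LipFun X)
    {f : X → ℝ} (hf : Measurable f) (hb : ∃ C : ℝ, ∀ x, |f x| ≤ C) :
    borelExt (densityFunctional P F D) f π = ∫ x, f (F x) * D π x ∂P := by
  have := h.isFiniteMeasure_map π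
  exact _root_.borelExt_eq h.isMultilinear ⟨_, h.massBound⟩
    (B := fun f => ∫ x, f (F x) * D π x ∂P)
    (fun f g hf hg hfb hgb => h.enorm_integral_sub_le π hf hg hfb hgb) (fun u => rfl) hf hb

/-- Needed for the endpoint current, a difference of two curve currents. The difference is extended
directly, with the sum of the two dominating measures. -/
theorem borelExt_sub_eq {Ω' : Type*} [MeasurableSpace Ω'] {P' : Measure Ω'} {F' : Ω' → X}
    {D' : (Fin k → LipFun X) → Ω' → ℝ} {ρ' : Ω' → ℝ} (h : IsCurrentDensity P F D ρ)
    (h' : IsCurrentDensity P' F' D' ρ') (π : Fin k → LipFun X)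
    {f : X → ℝ} (hf : Measurable f) (hb : ∃ C : ℝ, ∀ x, |f x| ≤ C) :
    borelExt (densityFunctional P F D - densityFunctional P' F' D') f π =
      ∫ x, f (F x) * D π x ∂P - ∫ x, f (F' x) * D' π x ∂P' := by
  have := h.isFiniteMeasure_map π
  have := h'.isFiniteMeasure_map π
  refine _root_.borelExt_eq (h.isMultilinear.sub h'.isMultilinear)
    ⟨_, h.massBound.sub h'.massBound⟩
    (B := fun f => ∫ x, f (F x) * D π x ∂P - ∫ x, f (F' x) * D' π x ∂P')
    (ν := (P.withDensity fun x => ‖D π x‖ₑ).map F + (P'.withDensity fun x => ‖D' π x‖ₑ).map F')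
    (fun f g hf hg hfb hgb => ?_) (fun u => rfl) hf hb
  rw [lintegral_add_measure, sub_sub_sub_comm]
  exact enorm_sub_le.trans (add_le_add (h.enorm_integral_sub_le π hf hg hfb hgb)
    (h'.enorm_integral_sub_le π hf hg hfb hgb))

end IsCurrentDensity

end DensityFunctional

/-! ### The current of a Lipschitz curve -/

section CurveCurrent

variable {X : Type*} [MetricSpace X]

/-- The extension of a curve to the real line which is constant outside of `[0, 1]`. -/
noncomputable def curveExt (γ : LipCurve X) (s : ℝ) : X := γ.1 (projIcc 0 1 zero_le_one s)

theorem constOutsideUnit_curveExt (γ : LipCurve X) : ConstOutsideUnit (curveExt γ) :=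
  ⟨fun s hs => by simp [curveExt, projIcc_of_le_left zero_le_one hs],
    fun s hs => by simp [curveExt, projIcc_of_right_le zero_le_one hs]⟩

theorem lipschitzWith_curveExt {γ : LipCurve X} {K : ℝ≥0} (hK : LipschitzWith K γ.1) :
    LipschitzWith K (curveExt γ) := by
  have := hK.comp (LipschitzWith.projIcc (zero_le_one (α := ℝ)))
  rwa [mul_one] at this

/-- The densities of the current induced by a curve. -/
noncomputable def curveDensity (γ : LipCurve X) (π : Fin 1 → LipFun X) : ℝ → ℝ :=
  deriv fun s => (π 0).1 (curveExt γ s)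

theorem curveDensity_eq_zero (γ : LipCurve X) (π : Fin 1 → LipFun X) {s : ℝ}
    (hs : s ∉ Icc (0 : ℝ) 1) : curveDensity γ π s = 0 :=
  ((constOutsideUnit_curveExt γ).comp _).deriv_eq_zero hs

theorem curveCurrent_eq_densityFunctional (γ : LipCurve X) :
    curveCurrent γ = densityFunctional volume (curveExt γ) (curveDensity γ) := by
  ext f π
  simp only [curveCurrent, densityFunctional]
  rw [intervalIntegral.integral_of_le zero_le_one, ← integral_Icc_eq_integral_Ioc]
  exact setIntegral_eq_integral_of_forall_compl_eq_zero fun s hs => by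
    change _ * curveDensity γ π s = 0
    rw [curveDensity_eq_zero γ π hs, mul_zero]

variable [MeasurableSpace X] [BorelSpace X]

theorem isCurrentDensity_curveDensity {γ : LipCurve X} {K : ℝ≥0} (hK : LipschitzWith K γ.1) :
    IsCurrentDensity volume (curveExt γ) (curveDensity γ)
      ((Icc (0 : ℝ) 1).indicator fun _ => (K : ℝ)) := by
  have hg := lipschitzWith_curveExt hK
  have hlip : ∀ p : LipFun X, LipschitzWith ((lipConst p).toNNReal * K)
      fun s => p.1 (curveExt γ s) := fun p => (lipschitzWith_lipConst p).comp hg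
  have hρ : Integrable ((Icc (0 : ℝ) 1).indicator fun _ => (K : ℝ)) := by
    rw [integrable_indicator_iff measurableSet_Icc]
    exact integrableOn_const (by simp)
  have hbound : ∀ π s, |curveDensity γ π s| ≤
      (∏ i, lipConst (π i)) * (Icc (0 : ℝ) 1).indicator (fun _ => (K : ℝ)) s := by
    intro π s
    by_cases hs : s ∈ Icc (0 : ℝ) 1
    · have := norm_deriv_le_of_lipschitz (hlip (π 0)) (x₀ := s)
      rw [NNReal.coe_mul, Real.coe_toNNReal _ (lipConst_nonneg _)] at this
      simpa [hs, curveDensity] using this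
    · simp [hs, curveDensity_eq_zero γ π hs]
  have hdiff : ∀ p : LipFun X, ∀ᵐ s, DifferentiableAt ℝ (fun s => p.1 (curveExt γ s)) s :=
    fun p => (hlip p).ae_differentiableAt_real
  refine ⟨hg.continuous.measurable, fun π => ?_, hρ, fun s => ?_, fun π i p q => ?_,
    fun π i c p => ?_, fun π => .of_forall (hbound π), fun π i c U hU hc s hs => ?_⟩
  · exact (hρ.const_mul _).mono' (measurable_deriv _).aestronglyMeasurable
      (.of_forall (hbound π))
  · exact indicator_nonneg (fun _ _ => K.2) s
  · obtain rfl := Subsingleton.elim i 0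
    filter_upwards [hdiff p, hdiff q] with s hp hq
    simp only [curveDensity, Function.update_self]
    exact deriv_add hp hq
  · obtain rfl := Subsingleton.elim i 0
    filter_upwards [hdiff p] with s hp
    simp only [curveDensity, Function.update_self]
    exact deriv_const_mul c hp
  · obtain rfl := Subsingleton.elim i 0
    have : (fun s => (π 0).1 (curveExt γ s)) =ᶠ[𝓝 s] fun _ => c := by
      filter_upwards [hg.continuous.continuousAt.preimage_mem_nhds (hU.mem_nhds hs)] with r hr
      exact hc _ hr
    rw [curveDensity, this.deriv_eq, deriv_const]

/-- Intended for geodesics: there the Lipschitz constant `d(x, y)` is also the length, so this crude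
bound loses nothing. -/
theorem exists_massBound_curveCurrent {γ : LipCurve X} {K : ℝ≥0} (hK : LipschitzWith K γ.1) :
    ∃ μ : Measure X, MassBound (curveCurrent γ) μ ∧ μ univ = K := by
  rw [curveCurrent_eq_densityFunctional]
  refine ⟨_, (isCurrentDensity_curveDensity hK).massBound, ?_⟩
  rw [(isCurrentDensity_curveDensity hK).map_withDensity_univ]
  have : ∀ s, ENNReal.ofReal ((Icc (0 : ℝ) 1).indicator (fun _ => (K : ℝ)) s) =
      (Icc (0 : ℝ) 1).indicator (fun _ => (K : ℝ≥0∞)) s := fun s => by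
    by_cases hs : s ∈ Icc (0 : ℝ) 1 <;> simp [hs]
  simp only [this]
  rw [lintegral_indicator measurableSet_Icc]
  simp

theorem isMetricCurrent_curveCurrent (γ : LipCurve X) : IsMetricCurrent (curveCurrent γ) := by
  obtain ⟨K, hK⟩ := γ.2
  have hg := lipschitzWith_curveExt hK
  rw [curveCurrent_eq_densityFunctional]
  refine (isCurrentDensity_curveDensity hK).isMetricCurrent ?_
  rintro f πs π ⟨C, hC⟩ hlim
  obtain ⟨L, hL⟩ := f.2.1
  obtain ⟨M, hM⟩ := lipschitzWith_unitCutoff.exists_mul_of_hasCompactSupport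
    hasCompactSupport_unitCutoff (hL.comp hg)
  -- The density vanishes off `[0, 1]`, so the cutoff is free and supplies the compact support that
  -- weak continuity requires.
  have hcut : ∀ p s, f.1 (curveExt γ s) * curveDensity γ p s =
      (unitCutoff s * f.1 (curveExt γ s)) * curveDensity γ p s := by
    intro p s
    by_cases hs : s ∈ Icc (0 : ℝ) 1
    · rw [unitCutoff_eq_one hs, one_mul]
    · rw [curveDensity_eq_zero γ p hs, mul_zero, mul_zero]
  simp only [densityFunctional, hcut]
  exact tendsto_integral_mul_deriv hM hasCompactSupport_unitCutoff.mul_right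
    (fun n => (lipschitzWith_of_lipConst_le (hC n 0)).comp hg)
    ((lipschitzWith_lipConst (π 0)).comp hg) fun s => hlim 0 _

end CurveCurrent

/-! ### The length function as a substitute for metric speed -/

section LengthFunction

variable {X : Type*} [MetricSpace X]

/-- The length of the part of the curve `γ` over `[0, s]`. -/
noncomputable def lengthFun (γ : LipCurve X) (s : ℝ) : ℝ :=
  variationOnFromTo (curveExt γ) univ 0 s

theorem locallyBoundedVariationOn_curveExt (γ : LipCurve X) :
    LocallyBoundedVariationOn (curveExt γ) univ := by
  obtain ⟨K, hK⟩ := γ.2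
  exact (lipschitzWith_curveExt hK).locallyBoundedVariationOn univ

theorem monotone_lengthFun (γ : LipCurve X) : Monotone (lengthFun γ) :=
  monotoneOn_univ.mp
    (variationOnFromTo.monotoneOn (locallyBoundedVariationOn_curveExt γ) (mem_univ 0))

theorem dist_curveExt_le (γ : LipCurve X) (s s' : ℝ) :
    dist (curveExt γ s) (curveExt γ s') ≤ |lengthFun γ s - lengthFun γ s'| := by
  wlog h : s' ≤ s generalizing s s'
  · rw [dist_comm, abs_sub_comm]
    exact this s' s (le_of_not_ge h)
  have hb := locallyBoundedVariationOn_curveExt γ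
  rw [lengthFun, lengthFun, variationOnFromTo.sub_right hb (mem_univ _) (mem_univ _) (mem_univ _),
    variationOnFromTo.eq_of_le _ _ h, abs_of_nonneg ENNReal.toReal_nonneg, dist_comm]
  rw [dist_edist]
  exact ENNReal.toReal_mono (hb s' s (mem_univ _) (mem_univ _))
    (eVariationOn.edist_le _ ⟨mem_univ _, le_rfl, h⟩ ⟨mem_univ _, h, le_rfl⟩)

theorem deriv_lengthFun_nonneg (γ : LipCurve X) (s : ℝ) : 0 ≤ deriv (lengthFun γ) s :=
  (monotone_lengthFun γ).deriv_nonneg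

/-- By Lebesgue, the derivative of a monotone function integrates to at most its increment. That
increment is the variation of the extended curve over `[0, 1]`, and the monotone reparametrization
`projIcc` cannot increase variation. -/
theorem ofReal_integral_deriv_lengthFun_le (γ : LipCurve X) :
    ENNReal.ofReal (∫ s in (0 : ℝ)..1, deriv (lengthFun γ) s) ≤ curveLength γ := by
  have h := ((monotone_lengthFun γ).monotoneOn (uIcc 0 1)).intervalIntegral_deriv_mem_uIcc
  rw [uIcc_of_le (sub_nonneg.mpr (monotone_lengthFun γ zero_le_one))] at h
  refine (ENNReal.ofReal_le_ofReal h.2).trans ?_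
  rw [lengthFun, lengthFun, variationOnFromTo.self, sub_zero,
    variationOnFromTo.eq_of_le _ _ zero_le_one]
  refine ENNReal.ofReal_toReal_le.trans ?_
  exact eVariationOn.comp_le_of_monotoneOn (fun t : I => γ.1 t) (projIcc 0 1 zero_le_one)
    ((monotone_projIcc zero_le_one).monotoneOn _) (mapsTo_univ _ _)

theorem ae_differentiableAt_lengthFun (γ : LipCurve X) :
    ∀ᵐ s, DifferentiableAt ℝ (lengthFun γ) s :=
  (monotone_lengthFun γ).ae_differentiableAt

theorem integrable_indicator_deriv_lengthFun (γ : LipCurve X) :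
    Integrable ((Icc (0 : ℝ) 1).indicator (deriv (lengthFun γ))) := by
  rw [integrable_indicator_iff measurableSet_Icc,
    ← intervalIntegrable_iff_integrableOn_Icc_of_le zero_le_one]
  exact ((monotone_lengthFun γ).monotoneOn _).intervalIntegrable_deriv

/-- A function whose increments are dominated by those of `Λ` has derivative dominated by that
of `Λ`. -/
theorem abs_deriv_le_abs_of_forall_abs_sub_le {g Λ : ℝ → ℝ} {s Λ' : ℝ}
    (h : ∀ r, |g r - g s| ≤ |Λ r - Λ s|) (hΛ : HasDerivAt Λ Λ' s) : |deriv g s| ≤ |Λ'| := by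
  by_cases hg : DifferentiableAt ℝ g s
  · have h₁ := (hasDerivAt_iff_tendsto_slope.mp hg.hasDerivAt).abs
    have h₂ := (hasDerivAt_iff_tendsto_slope.mp hΛ).abs
    refine le_of_tendsto_of_tendsto' h₁ h₂ fun r => ?_
    simp only [slope_def_field, abs_div]
    exact div_le_div_of_nonneg_right (h r) (abs_nonneg _)
  -- Where `g` is not differentiable, `deriv` is zero by convention and the bound is trivial.
  · rw [deriv_zero_of_not_differentiableAt hg, abs_zero]
    exact abs_nonneg _

end LengthFunction

/-! ### Continuity of a conical bicombing -/

namespace IsConicalGeodesicBicombing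

variable {X : Type*} [MetricSpace X] {bic : X → X → I → X}

theorem dist_le (hb : IsConicalGeodesicBicombing bic) (x y x' y' : X) (t : I) :
    dist (bic x y t) (bic x' y' t) ≤ dist x x' + dist y y' := by
  refine (hb.conical x y x' y' t).trans (add_le_add ?_ ?_)
  · exact mul_le_of_le_one_left dist_nonneg (by linarith [t.2.1])
  · exact mul_le_of_le_one_left dist_nonneg t.2.2

theorem continuous (hb : IsConicalGeodesicBicombing bic) :
    Continuous fun q : X × X × I => bic q.1 q.2.1 q.2.2 := by
  rw [continuous_iff_continuousAt]
  rintro ⟨x, y, t⟩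
  rw [ContinuousAt, tendsto_iff_dist_tendsto_zero]
  refine squeeze_zero (fun _ => dist_nonneg)
    (g := fun q : X × X × I => (dist q.1 x + dist q.2.1 y) + |(q.2.2 : ℝ) - t| * dist x y)
    (fun q => ?_) ?_
  · refine (dist_triangle _ (bic x y q.2.2) _).trans (add_le_add (hb.dist_le _ _ _ _ _) ?_)
    rw [hb.geodesic]
  · have hc : Continuous fun q : X × X × I =>
        (dist q.1 x + dist q.2.1 y) + |(q.2.2 : ℝ) - t| * dist x y := by fun_prop
    have := hc.tendsto (x, y, t)
    simpa using this

theorem lipschitzWith (hb : IsConicalGeodesicBicombing bic) (x y : X) :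
    LipschitzWith (nndist x y) (bic x y) :=
  LipschitzWith.of_dist_le_mul fun s t => by
    rw [hb.geodesic, coe_nndist, mul_comm, Subtype.dist_eq, Real.dist_eq]

/-- The geodesics of a bicombing, as Lipschitz curves. -/
def geodesicCurve (hb : IsConicalGeodesicBicombing bic) (x y : X) : LipCurve X :=
  ⟨⟨bic x y, (hb.lipschitzWith x y).continuous⟩, _, hb.lipschitzWith x y⟩

end IsConicalGeodesicBicombing

/-! ### The geodesic homotopy and its partial derivatives -/

section Homotopy

variable {X : Type*} [MetricSpace X]

/-- The geodesic homotopy between two curves, extended to the plane. -/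
noncomputable def geodesicHomotopy (bic : X → X → I → X) (γ₀ γ₁ : LipCurve X) (x : ℝ × ℝ) : X :=
  bic (curveExt γ₀ x.1) (curveExt γ₁ x.1) (projIcc 0 1 zero_le_one x.2)

theorem constOutsideSquare_geodesicHomotopy (bic : X → X → I → X) (γ₀ γ₁ : LipCurve X) :
    ConstOutsideSquare (geodesicHomotopy bic γ₀ γ₁) := by
  have h₀ := constOutsideUnit_curveExt γ₀
  have h₁ := constOutsideUnit_curveExt γ₁
  refine ⟨fun t => ⟨fun s hs => ?_, fun s hs => ?_⟩, fun s => ⟨fun t ht => ?_, fun t ht => ?_⟩⟩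
  · simp only [geodesicHomotopy, h₀.left s hs, h₁.left s hs]
  · simp only [geodesicHomotopy, h₀.right s hs, h₁.right s hs]
  · simp only [geodesicHomotopy, projIcc_of_le_left zero_le_one ht, projIcc_left]
  · simp only [geodesicHomotopy, projIcc_of_right_le zero_le_one ht, projIcc_right]

theorem dist_curveExt_le_dist (γ₀ γ₁ : LipCurve X) (s : ℝ) :
    dist (curveExt γ₀ s) (curveExt γ₁ s) ≤ dist γ₀ γ₁ :=
  ContinuousMap.dist_apply_le_dist _

variable {bic : X → X → I → X}

theorem dist_geodesicHomotopy_snd_le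
    (hb : IsConicalGeodesicBicombing bic) (γ₀ γ₁ : LipCurve X) (s t t' : ℝ) :
    dist (geodesicHomotopy bic γ₀ γ₁ (s, t)) (geodesicHomotopy bic γ₀ γ₁ (s, t')) ≤
      dist γ₀ γ₁ * dist t t' := by
  rw [geodesicHomotopy, geodesicHomotopy, hb.geodesic, mul_comm]
  refine mul_le_mul (dist_curveExt_le_dist γ₀ γ₁ s) ?_ (abs_nonneg _) dist_nonneg
  have := (LipschitzWith.projIcc (zero_le_one (α := ℝ))).dist_le_mul t t'
  rwa [NNReal.coe_one, one_mul, Subtype.dist_eq, Real.dist_eq] at this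

/-- Conicality with its weights kept: bounding `1 - t` and `t` by 1 would double the final mass
estimate. -/
theorem dist_geodesicHomotopy_fst_le
    (hb : IsConicalGeodesicBicombing bic) (γ₀ γ₁ : LipCurve X) (s s' : ℝ) {t : ℝ}
    (ht : t ∈ Icc (0 : ℝ) 1) :
    dist (geodesicHomotopy bic γ₀ γ₁ (s, t)) (geodesicHomotopy bic γ₀ γ₁ (s', t)) ≤
      (1 - t) * dist (curveExt γ₀ s) (curveExt γ₀ s') + t * dist (curveExt γ₁ s) (curveExt γ₁ s') := by
  have := hb.conical (curveExt γ₀ s) (curveExt γ₁ s) (curveExt γ₀ s') (curveExt γ₁ s')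
    (projIcc 0 1 zero_le_one t)
  rw [geodesicHomotopy, geodesicHomotopy]
  rwa [projIcc_of_mem zero_le_one ht] at this ⊢

theorem exists_lipschitzWith_geodesicHomotopy
    (hb : IsConicalGeodesicBicombing bic) (γ₀ γ₁ : LipCurve X) :
    ∃ K : ℝ≥0, LipschitzWith K (geodesicHomotopy bic γ₀ γ₁) := by
  obtain ⟨K₀, hK₀⟩ := γ₀.2
  obtain ⟨K₁, hK₁⟩ := γ₁.2
  refine ⟨K₀ + K₁ + nndist γ₀ γ₁, LipschitzWith.of_dist_le_mul ?_⟩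
  rintro ⟨s, t⟩ ⟨s', t'⟩
  have h₁ : dist s s' ≤ dist (s, t) (s', t') := le_max_left _ _
  have h₂ : dist t t' ≤ dist (s, t) (s', t') := le_max_right _ _
  calc dist (geodesicHomotopy bic γ₀ γ₁ (s, t)) (geodesicHomotopy bic γ₀ γ₁ (s', t'))
      ≤ dist (geodesicHomotopy bic γ₀ γ₁ (s, t)) (geodesicHomotopy bic γ₀ γ₁ (s', t)) +
          dist (geodesicHomotopy bic γ₀ γ₁ (s', t)) (geodesicHomotopy bic γ₀ γ₁ (s', t')) :=
        dist_triangle _ _ _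
    _ ≤ (dist (curveExt γ₀ s) (curveExt γ₀ s') + dist (curveExt γ₁ s) (curveExt γ₁ s')) +
          dist γ₀ γ₁ * dist t t' :=
        add_le_add (hb.dist_le _ _ _ _ _) (dist_geodesicHomotopy_snd_le hb γ₀ γ₁ s' t t')
    _ ≤ (K₀ * dist s s' + K₁ * dist s s') + dist γ₀ γ₁ * dist t t' := by
        gcongr
        · exact (lipschitzWith_curveExt hK₀).dist_le_mul s s'
        · exact (lipschitzWith_curveExt hK₁).dist_le_mul s s'
    _ ≤ (K₀ * dist (s, t) (s', t') + K₁ * dist (s, t) (s', t')) +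
          dist γ₀ γ₁ * dist (s, t) (s', t') := by gcongr
    _ = _ := by push_cast; ring

theorem abs_lineDeriv_geodesicHomotopy_snd_le
    (hb : IsConicalGeodesicBicombing bic) (γ₀ γ₁ : LipCurve X) (p : LipFun X) (x : ℝ × ℝ) :
    |lineDeriv ℝ (fun x => p.1 (geodesicHomotopy bic γ₀ γ₁ x)) x (0, 1)| ≤
      lipConst p * dist γ₀ γ₁ := by
  rw [lineDeriv_prod_zero_one]
  have h : LipschitzWith ((lipConst p).toNNReal * nndist γ₀ γ₁)
      fun t => p.1 (geodesicHomotopy bic γ₀ γ₁ (x.1, t)) :=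
    (lipschitzWith_lipConst p).comp (LipschitzWith.of_dist_le_mul fun t t' =>
      dist_geodesicHomotopy_snd_le hb γ₀ γ₁ x.1 t t')
  have := norm_deriv_le_of_lipschitz h (x₀ := x.2)
  rwa [NNReal.coe_mul, Real.coe_toNNReal _ (lipConst_nonneg p)] at this

/-- For fixed `t`, the increments of `p ∘ H` in `s` are dominated by those of `LIP(p) ((1 - t) Λ₀ +
t Λ₁)`, so only the length functions have to be differentiable. -/
theorem abs_lineDeriv_geodesicHomotopy_fst_le
    (hb : IsConicalGeodesicBicombing bic) (γ₀ γ₁ : LipCurve X) (p : LipFun X) {x : ℝ × ℝ}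
    (hx : x.2 ∈ Icc (0 : ℝ) 1) (h₀ : DifferentiableAt ℝ (lengthFun γ₀) x.1)
    (h₁ : DifferentiableAt ℝ (lengthFun γ₁) x.1) :
    |lineDeriv ℝ (fun x => p.1 (geodesicHomotopy bic γ₀ γ₁ x)) x (1, 0)| ≤
      lipConst p * ((1 - x.2) * deriv (lengthFun γ₀) x.1 + x.2 * deriv (lengthFun γ₁) x.1) := by
  rw [lineDeriv_prod_one_zero]
  have ht₀ : 0 ≤ 1 - x.2 := by linarith [hx.2]
  have ht₁ : 0 ≤ x.2 := hx.1
  have hp := lipConst_nonneg p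
  have hnn : 0 ≤ lipConst p *
      ((1 - x.2) * deriv (lengthFun γ₀) x.1 + x.2 * deriv (lengthFun γ₁) x.1) := by
    have := deriv_lengthFun_nonneg γ₀ x.1
    have := deriv_lengthFun_nonneg γ₁ x.1
    positivity
  rw [← abs_of_nonneg hnn]
  refine abs_deriv_le_abs_of_forall_abs_sub_le
    (Λ := fun s => lipConst p * ((1 - x.2) * lengthFun γ₀ s + x.2 * lengthFun γ₁ s)) (fun r => ?_)
    (((h₀.hasDerivAt.const_mul _).add (h₁.hasDerivAt.const_mul _)).const_mul _)
  -- Both length functions are monotone, so their increments have the same sign and the weighted sum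
  -- of absolute values is the absolute value of the weighted sum.
  have same : ∀ a b a' b' : ℝ, (0 ≤ a - b ∧ 0 ≤ a' - b') ∨ (a - b ≤ 0 ∧ a' - b' ≤ 0) →
      (1 - x.2) * |a - b| + x.2 * |a' - b'| =
        |((1 - x.2) * a + x.2 * a') - ((1 - x.2) * b + x.2 * b')| := by
    rintro a b a' b' (⟨k, k'⟩ | ⟨k, k'⟩)
    · rw [abs_of_nonneg k, abs_of_nonneg k', abs_of_nonneg] <;> nlinarith
    · rw [abs_of_nonpos k, abs_of_nonpos k', abs_of_nonpos] <;> nlinarith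
  rw [← mul_sub, abs_mul, abs_of_nonneg hp, ← same]
  · refine (abs_sub_le_lipConst_mul p _ _).trans (mul_le_mul_of_nonneg_left ?_ hp)
    refine (dist_geodesicHomotopy_fst_le hb γ₀ γ₁ r x.1 hx).trans ?_
    gcongr <;> exact dist_curveExt_le _ _ _
  · rcases le_total x.1 r with h | h
    · exact Or.inl ⟨sub_nonneg.mpr (monotone_lengthFun γ₀ h),
        sub_nonneg.mpr (monotone_lengthFun γ₁ h)⟩
    · exact Or.inr ⟨sub_nonpos.mpr (monotone_lengthFun γ₀ h),
        sub_nonpos.mpr (monotone_lengthFun γ₁ h)⟩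

end Homotopy

/-! ### The homotopy current: mass, boundary, normality -/

section HomotopyCurrent

variable {X : Type*} [MetricSpace X]

/-- The densities of the current swept out by the geodesic homotopy between two curves. -/
noncomputable def homotopyDensity (bic : X → X → I → X) (γ₀ γ₁ : LipCurve X)
    (π : Fin 2 → LipFun X) : ℝ × ℝ → ℝ :=
  planarJacobian (fun x => (π 0).1 (geodesicHomotopy bic γ₀ γ₁ x))
    fun x => (π 1).1 (geodesicHomotopy bic γ₀ γ₁ x)

/-- The current swept out by the geodesic homotopy between two curves. -/
noncomputable def homotopyCurrent (bic : X → X → I → X) (γ₀ γ₁ : LipCurve X) : Functional X 2 :=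
  densityFunctional volume (geodesicHomotopy bic γ₀ γ₁) (homotopyDensity bic γ₀ γ₁)

/-- The density on the unit square which bounds the mass of the homotopy current. -/
noncomputable def homotopyMassDensity (γ₀ γ₁ : LipCurve X) (x : ℝ × ℝ) : ℝ :=
  (Icc (0 : ℝ) 1).indicator (deriv (lengthFun γ₀)) x.1 *
      (Icc (0 : ℝ) 1).indicator (fun t => 2 * dist γ₀ γ₁ * (1 - t)) x.2 +
    (Icc (0 : ℝ) 1).indicator (deriv (lengthFun γ₁)) x.1 *
      (Icc (0 : ℝ) 1).indicator (fun t => 2 * dist γ₀ γ₁ * t) x.2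

theorem homotopyMassDensity_nonneg (γ₀ γ₁ : LipCurve X) (x : ℝ × ℝ) :
    0 ≤ homotopyMassDensity γ₀ γ₁ x := by
  have h : ∀ γ : LipCurve X, 0 ≤ (Icc (0 : ℝ) 1).indicator (deriv (lengthFun γ)) x.1 := fun γ =>
    indicator_nonneg (fun s _ => deriv_lengthFun_nonneg γ s) _
  have hd : 0 ≤ 2 * dist γ₀ γ₁ := by positivity
  refine add_nonneg (mul_nonneg (h γ₀) (indicator_nonneg (fun t ht => ?_) _))
    (mul_nonneg (h γ₁) (indicator_nonneg (fun t ht => mul_nonneg hd ht.1) _))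
  exact mul_nonneg hd (by linarith [ht.2])

theorem integrable_indicator_unit {g : ℝ → ℝ} (hg : Continuous g) :
    Integrable ((Icc (0 : ℝ) 1).indicator g) := by
  rw [integrable_indicator_iff measurableSet_Icc]
  exact hg.continuousOn.integrableOn_compact isCompact_Icc

theorem integrable_homotopyMassDensity (γ₀ γ₁ : LipCurve X) :
    Integrable (homotopyMassDensity γ₀ γ₁) :=
  ((integrable_indicator_deriv_lengthFun γ₀).mul_prod
    (integrable_indicator_unit (by fun_prop))).add
  ((integrable_indicator_deriv_lengthFun γ₁).mul_prod (integrable_indicator_unit (by fun_prop)))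

/-- The density is a sum of products, so Fubini applies. Each `t`-factor integrates to exactly
`d_∞`, since `2 ∫ (1 - t) = 2 ∫ t = 1`, and each `s`-factor to at most a length. -/
theorem lintegral_homotopyMassDensity_le (γ₀ γ₁ : LipCurve X) :
    ∫⁻ x, ENNReal.ofReal (homotopyMassDensity γ₀ γ₁ x) ≤
      (curveLength γ₀ + curveLength γ₁) * edist γ₀ γ₁ := by
  rw [← ofReal_integral_eq_lintegral_ofReal (integrable_homotopyMassDensity γ₀ γ₁)
    (.of_forall (homotopyMassDensity_nonneg γ₀ γ₁))]
  have h₀ := (integrable_indicator_deriv_lengthFun γ₀).mul_prod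
    (integrable_indicator_unit (g := fun t => 2 * dist γ₀ γ₁ * (1 - t)) (by fun_prop))
  have h₁ := (integrable_indicator_deriv_lengthFun γ₁).mul_prod
    (integrable_indicator_unit (g := fun t => 2 * dist γ₀ γ₁ * t) (by fun_prop))
  have hI : ∀ g : ℝ → ℝ, ∫ t, (Icc (0 : ℝ) 1).indicator g t = ∫ t in (0 : ℝ)..1, g t := fun g => by
    rw [integral_indicator measurableSet_Icc, integral_Icc_eq_integral_Ioc,
      intervalIntegral.integral_of_le zero_le_one]
  have e₀ : ∫ t in (0 : ℝ)..1, 2 * dist γ₀ γ₁ * (1 - t) = dist γ₀ γ₁ := by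
    rw [intervalIntegral.integral_const_mul, intervalIntegral.integral_sub (by simp) (by simp)]
    simp
    ring
  have e₁ : ∫ t in (0 : ℝ)..1, 2 * dist γ₀ γ₁ * t = dist γ₀ γ₁ := by
    rw [intervalIntegral.integral_const_mul]
    simp
    ring
  have key : ∫ x, homotopyMassDensity γ₀ γ₁ x =
      ((∫ s in (0 : ℝ)..1, deriv (lengthFun γ₀) s) +
        ∫ s in (0 : ℝ)..1, deriv (lengthFun γ₁) s) * dist γ₀ γ₁ := by
    simp only [homotopyMassDensity]
    rw [Measure.volume_eq_prod]
    rw [integral_add h₀ h₁, integral_prod_mul, integral_prod_mul, hI, hI, hI, hI, e₀, e₁]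
    ring
  rw [key, ENNReal.ofReal_mul' dist_nonneg, edist_dist]
  gcongr
  exact ENNReal.ofReal_add_le.trans (add_le_add (ofReal_integral_deriv_lengthFun_le γ₀)
    (ofReal_integral_deriv_lengthFun_le γ₁))

variable {bic : X → X → I → X}

/-- Both terms of the Jacobian pair one `s`-derivative with one `t`-derivative and obey the same
bound, whence the 2 in `homotopyMassDensity`. -/
theorem abs_homotopyDensity_le (hb : IsConicalGeodesicBicombing bic) (γ₀ γ₁ : LipCurve X)
    (π : Fin 2 → LipFun X) : ∀ᵐ x, |homotopyDensity bic γ₀ γ₁ π x| ≤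
      (∏ i, lipConst (π i)) * homotopyMassDensity γ₀ γ₁ x := by
  have hae : ∀ γ : LipCurve X, ∀ᵐ x : ℝ × ℝ, DifferentiableAt ℝ (lengthFun γ) x.1 := fun γ =>
    Measure.quasiMeasurePreserving_fst.ae (ae_differentiableAt_lengthFun γ)
  have hF := constOutsideSquare_geodesicHomotopy bic γ₀ γ₁
  filter_upwards [hae γ₀, hae γ₁] with x h₀ h₁
  rw [Fin.prod_univ_two]
  by_cases hx : x ∈ Icc (0 : ℝ) 1 ×ˢ Icc (0 : ℝ) 1
  · have s₀ := abs_lineDeriv_geodesicHomotopy_fst_le hb γ₀ γ₁ (π 0) hx.2 h₀ h₁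
    have s₁ := abs_lineDeriv_geodesicHomotopy_fst_le hb γ₀ γ₁ (π 1) hx.2 h₀ h₁
    have t₀ := abs_lineDeriv_geodesicHomotopy_snd_le hb γ₀ γ₁ (π 0) x
    have t₁ := abs_lineDeriv_geodesicHomotopy_snd_le hb γ₀ γ₁ (π 1) x
    have k₁ := mul_le_mul s₀ t₁ (abs_nonneg _) ((abs_nonneg _).trans s₀)
    have k₂ := mul_le_mul t₀ s₁ (abs_nonneg _) ((abs_nonneg _).trans t₀)
    rw [← abs_mul] at k₁ k₂
    refine (abs_sub _ _).trans ((add_le_add k₁ k₂).trans (le_of_eq ?_))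
    rw [homotopyMassDensity, indicator_of_mem hx.1, indicator_of_mem hx.1, indicator_of_mem hx.2,
      indicator_of_mem hx.2]
    ring
  · rw [homotopyDensity, (hF.comp _).planarJacobian_eq_zero (hF.comp _) hx, abs_zero]
    exact mul_nonneg (mul_nonneg (lipConst_nonneg _) (lipConst_nonneg _))
      (homotopyMassDensity_nonneg γ₀ γ₁ x)

/-- The difference of the geodesics which join the initial points and the final points of two
curves. -/
noncomputable def endpointCurrent (hb : IsConicalGeodesicBicombing bic) (γ₀ γ₁ : LipCurve X) :
    Functional X 1 :=
  curveCurrent (hb.geodesicCurve (γ₀.1 0) (γ₁.1 0)) -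
    curveCurrent (hb.geodesicCurve (γ₀.1 1) (γ₁.1 1))

/-- Green's formula for `f ∘ H` and `π ∘ H`; the equations `b₀`, `b₁`, `c₀`, `c₁` name the four
edges of the homotopy. -/
theorem curveCurrent_sub_eq (hb : IsConicalGeodesicBicombing bic) (γ₀ γ₁ : LipCurve X) :
    curveCurrent γ₀ - curveCurrent γ₁ =
      boundary (homotopyCurrent bic γ₀ γ₁) + endpointCurrent hb γ₀ γ₁ := by
  obtain ⟨K, hK⟩ := exists_lipschitzWith_geodesicHomotopy hb γ₀ γ₁
  have hF := constOutsideSquare_geodesicHomotopy bic γ₀ γ₁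
  have b₀ : ∀ s, geodesicHomotopy bic γ₀ γ₁ (s, 0) = curveExt γ₀ s := fun s => by
    simp [geodesicHomotopy, hb.source]
  have b₁ : ∀ s, geodesicHomotopy bic γ₀ γ₁ (s, 1) = curveExt γ₁ s := fun s => by
    simp [geodesicHomotopy, hb.target]
  have c₀ : ∀ t, geodesicHomotopy bic γ₀ γ₁ (0, t) =
      curveExt (hb.geodesicCurve (γ₀.1 0) (γ₁.1 0)) t := fun t => by
    simp [geodesicHomotopy, curveExt, IsConicalGeodesicBicombing.geodesicCurve]
  have c₁ : ∀ t, geodesicHomotopy bic γ₀ γ₁ (1, t) =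
      curveExt (hb.geodesicCurve (γ₀.1 1) (γ₁.1 1)) t := fun t => by
    simp [geodesicHomotopy, curveExt, IsConicalGeodesicBicombing.geodesicCurve]
  ext f π
  have green := integral_planarJacobian_eq_boundary (hF.comp f.1) (hF.comp (π 0).1)
    (f.2.1.choose_spec.comp hK) ((lipschitzWith_lipConst (π 0)).comp hK)
  simp only [b₀, b₁, c₀, c₁] at green
  have hbd : boundary (homotopyCurrent bic γ₀ γ₁) f π =
      ∫ x, planarJacobian (fun x => f.1 (geodesicHomotopy bic γ₀ γ₁ x))
        (fun x => (π 0).1 (geodesicHomotopy bic γ₀ γ₁ x)) x := by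
    simp only [boundary, homotopyCurrent, densityFunctional, BddLipFun.one, one_mul]
    rfl
  simp only [endpointCurrent, curveCurrent_eq_densityFunctional, Pi.sub_apply, Pi.add_apply, hbd,
    green]
  simp only [densityFunctional, curveDensity]
  ring

variable [MeasurableSpace X] [BorelSpace X]

theorem isCurrentDensity_homotopyDensity (hb : IsConicalGeodesicBicombing bic)
    (γ₀ γ₁ : LipCurve X) :
    IsCurrentDensity volume (geodesicHomotopy bic γ₀ γ₁) (homotopyDensity bic γ₀ γ₁)
      (homotopyMassDensity γ₀ γ₁) := by
  obtain ⟨K, hK⟩ := exists_lipschitzWith_geodesicHomotopy hb γ₀ γ₁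
  have hF := constOutsideSquare_geodesicHomotopy bic γ₀ γ₁
  have hlip := fun p : LipFun X => (lipschitzWith_lipConst p).comp hK
  -- Linearity in the first entry suffices: the second follows by antisymmetry of the Jacobian, and
  -- homogeneity is the case `b = 0`.
  have left : ∀ (p q r : LipFun X) (a b : ℝ),
      planarJacobian (fun x => a * p.1 (geodesicHomotopy bic γ₀ γ₁ x) +
        b * q.1 (geodesicHomotopy bic γ₀ γ₁ x)) (fun x => r.1 (geodesicHomotopy bic γ₀ γ₁ x))
      =ᵐ[volume] fun x =>
        a * planarJacobian (fun x => p.1 (geodesicHomotopy bic γ₀ γ₁ x))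
          (fun x => r.1 (geodesicHomotopy bic γ₀ γ₁ x)) x +
        b * planarJacobian (fun x => q.1 (geodesicHomotopy bic γ₀ γ₁ x))
          (fun x => r.1 (geodesicHomotopy bic γ₀ γ₁ x)) x :=
    fun p q r a b => planarJacobian_ae_linear_left (hlip p) (hlip q) a b
  refine ⟨hK.continuous.measurable, fun π => ?_, integrable_homotopyMassDensity γ₀ γ₁,
    homotopyMassDensity_nonneg γ₀ γ₁, fun π i p q => ?_, fun π i c p => ?_,
    abs_homotopyDensity_le hb γ₀ γ₁, fun π i c U hU hc x hx => ?_⟩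
  · exact integrable_planarJacobian (hF.comp _) (hF.comp _) (hlip _) (hlip _)
  · fin_cases i
    · filter_upwards [left p q (π 1) 1 1] with x hx
      simpa [homotopyDensity] using hx
    · filter_upwards [left p q (π 0) 1 1] with x hx
      simp only [one_mul, planarJacobian_swap _ (fun x => (π 0).1 _)] at hx
      simp [homotopyDensity]
      linarith
  · fin_cases i
    · filter_upwards [left p 0 (π 1) c 0] with x hx
      simpa [homotopyDensity] using hx
    · filter_upwards [left p 0 (π 0) c 0] with x hx
      simp only [zero_mul, add_zero, planarJacobian_swap _ (fun x => (π 0).1 _)] at hx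
      simp [homotopyDensity]
      linarith
  · have : (fun x => (π i).1 (geodesicHomotopy bic γ₀ γ₁ x)) =ᶠ[𝓝 x] fun _ => c := by
      filter_upwards [hK.continuous.continuousAt.preimage_mem_nhds (hU.mem_nhds hx)] with r hr
      exact hc _ hr
    have hz : ∀ e, lineDeriv ℝ (fun x => (π i).1 (geodesicHomotopy bic γ₀ γ₁ x)) x e = 0 :=
      fun e => by
        rw [this.lineDeriv_eq]
        simp [lineDeriv]
    fin_cases i
    · change ∀ e, lineDeriv ℝ (fun x => (π 0).1 _) x e = 0 at hz
      simp [homotopyDensity, planarJacobian, hz]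
    · change ∀ e, lineDeriv ℝ (fun x => (π 1).1 _) x e = 0 at hz
      simp [homotopyDensity, planarJacobian, hz]

theorem isMetricCurrent_homotopyCurrent (hb : IsConicalGeodesicBicombing bic)
    (γ₀ γ₁ : LipCurve X) : IsMetricCurrent (homotopyCurrent bic γ₀ γ₁) := by
  obtain ⟨K, hK⟩ := exists_lipschitzWith_geodesicHomotopy hb γ₀ γ₁
  have hF := constOutsideSquare_geodesicHomotopy bic γ₀ γ₁
  refine (isCurrentDensity_homotopyDensity hb γ₀ γ₁).isMetricCurrent ?_
  rintro f πs π ⟨C, hC⟩ hlim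
  obtain ⟨L, hL⟩ := f.2.1
  obtain ⟨M, hM⟩ := lipschitzWith_squareCutoff.exists_mul_of_hasCompactSupport
    hasCompactSupport_squareCutoff (hL.comp hK)
  have hcut : ∀ p x, f.1 (geodesicHomotopy bic γ₀ γ₁ x) * homotopyDensity bic γ₀ γ₁ p x =
      (squareCutoff x * f.1 (geodesicHomotopy bic γ₀ γ₁ x)) *
        homotopyDensity bic γ₀ γ₁ p x := by
    intro p x
    rw [mul_comm (squareCutoff x), mul_assoc, homotopyDensity,
      squareCutoff_mul_planarJacobian (hF.comp _) (hF.comp _)]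
  simp only [densityFunctional, hcut]
  exact tendsto_integral_mul_planarJacobian hM hasCompactSupport_squareCutoff.mul_right
    (fun n => (lipschitzWith_of_lipConst_le (hC n 0)).comp hK)
    (fun n => (lipschitzWith_of_lipConst_le (hC n 1)).comp hK)
    ((lipschitzWith_lipConst (π 0)).comp hK) ((lipschitzWith_lipConst (π 1)).comp hK)
    (fun x => hlim 0 _) fun x => hlim 1 _

theorem mass_homotopyCurrent_le (hb : IsConicalGeodesicBicombing bic) (γ₀ γ₁ : LipCurve X) :
    mass (homotopyCurrent bic γ₀ γ₁) ≤ (curveLength γ₀ + curveLength γ₁) * edist γ₀ γ₁ :=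
  (isCurrentDensity_homotopyDensity hb γ₀ γ₁).mass_le.trans (lintegral_homotopyMassDensity_le γ₀ γ₁)

theorem isMetricCurrent_endpointCurrent (hb : IsConicalGeodesicBicombing bic)
    (γ₀ γ₁ : LipCurve X) : IsMetricCurrent (endpointCurrent hb γ₀ γ₁) :=
  (isMetricCurrent_curveCurrent _).sub (isMetricCurrent_curveCurrent _)

/-- The boundary identity exhibits `∂S` as a combination of curve currents, all of which are metric
currents. -/
theorem isNormalCurrent_homotopyCurrent (hb : IsConicalGeodesicBicombing bic)
    (γ₀ γ₁ : LipCurve X) : IsNormalCurrent (homotopyCurrent bic γ₀ γ₁) := by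
  refine ⟨isMetricCurrent_homotopyCurrent hb γ₀ γ₁, ?_⟩
  rw [eq_sub_of_add_eq (curveCurrent_sub_eq hb γ₀ γ₁).symm]
  exact ((isMetricCurrent_curveCurrent _).sub (isMetricCurrent_curveCurrent _)).sub
    (isMetricCurrent_endpointCurrent hb γ₀ γ₁)

end HomotopyCurrent

/-! ### Measurable dependence of the integrals on parameters -/

section Measurability

variable {X : Type*} [MetricSpace X] [MeasurableSpace X] [BorelSpace X]
  {A : Type*} [TopologicalSpace A] [MeasurableSpace A] [OpensMeasurableSpace A]

/-- The derivative of a jointly continuous family is jointly measurable in parameter and point;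
integrating out one variable keeps measurability. -/
theorem measurable_integral_mul_deriv {h : A → ℝ → X} (hh : Continuous h.uncurry) {f : X → ℝ}
    (hf : Measurable f) (p : LipFun X) :
    Measurable fun a => ∫ s, f (h a s) * deriv (fun r => p.1 (h a r)) s := by
  have hp : Continuous p.1 := (lipschitzWith_lipConst p).continuous
  have hd : Measurable fun q : A × ℝ => deriv (fun r => p.1 (h q.1 r)) q.2 :=
    measurable_deriv_with_param (f := fun a r => p.1 (h a r)) (hp.comp hh)
  exact ((hf.comp hh.measurable).mul hd).stronglyMeasurable.integral_prod_right.measurable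

theorem measurable_integral_mul_planarJacobian {h : A → ℝ × ℝ → X} (hh : Continuous h.uncurry)
    {f : X → ℝ} (hf : Measurable f) (p q : LipFun X) :
    Measurable fun a => ∫ x, f (h a x) *
      planarJacobian (fun x => p.1 (h a x)) (fun x => q.1 (h a x)) x := by
  have h₁ : ∀ p : LipFun X, Measurable fun z : A × ℝ × ℝ =>
      lineDeriv ℝ (fun x => p.1 (h z.1 x)) z.2 (1, 0) := by
    intro p
    have hp : Continuous p.1 := (lipschitzWith_lipConst p).continuous
    -- The other coordinate joins the parameter, so a partial derivative becomes an ordinary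
    -- derivative with parameter in `A × ℝ`.
    have hc : Continuous (Function.uncurry fun (b : A × ℝ) r => p.1 (h b.1 (r, b.2))) :=
      hp.comp (hh.comp (by fun_prop :
        Continuous fun z : (A × ℝ) × ℝ => (z.1.1, ((z.2, z.1.2) : ℝ × ℝ))))
    have hm := (measurable_deriv_with_param hc).comp
      (by fun_prop : Measurable fun z : A × ℝ × ℝ => (((z.1, z.2.2) : A × ℝ), z.2.1))
    simp only [lineDeriv_prod_one_zero]
    exact hm
  have h₂ : ∀ p : LipFun X, Measurable fun z : A × ℝ × ℝ =>
      lineDeriv ℝ (fun x => p.1 (h z.1 x)) z.2 (0, 1) := by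
    intro p
    have hp : Continuous p.1 := (lipschitzWith_lipConst p).continuous
    have hc : Continuous (Function.uncurry fun (b : A × ℝ) r => p.1 (h b.1 (b.2, r))) :=
      hp.comp (hh.comp (by fun_prop :
        Continuous fun z : (A × ℝ) × ℝ => (z.1.1, ((z.1.2, z.2) : ℝ × ℝ))))
    have hm := (measurable_deriv_with_param hc).comp
      (by fun_prop : Measurable fun z : A × ℝ × ℝ => (((z.1, z.2.1) : A × ℝ), z.2.2))
    simp only [lineDeriv_prod_zero_one]
    exact hm
  have hd : Measurable fun z : A × ℝ × ℝ =>
      planarJacobian (fun x => p.1 (h z.1 x)) (fun x => q.1 (h z.1 x)) z.2 :=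
    ((h₁ p).mul (h₂ q)).sub ((h₂ p).mul (h₁ q))
  exact ((hf.comp hh.measurable).mul hd).stronglyMeasurable.integral_prod_right.measurable

end Measurability

/-! ### Joint continuity in the curves and the parameters -/

section Continuity

variable {X : Type*} [MetricSpace X] {bic : X → X → I → X}

theorem continuous_curveExt : Continuous fun z : LipCurve X × ℝ => curveExt z.1 z.2 := by
  have : Continuous fun z : LipCurve X × ℝ => (z.1.1, projIcc (0 : ℝ) 1 zero_le_one z.2) :=
    (continuous_subtype_val.comp continuous_fst).prodMk (continuous_projIcc.comp continuous_snd)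
  exact continuous_eval.comp this

theorem continuous_geodesicHomotopy (hb : IsConicalGeodesicBicombing bic) :
    Continuous (Function.uncurry fun (γ : LipCurve X × LipCurve X) (x : ℝ × ℝ) =>
      geodesicHomotopy bic γ.1 γ.2 x) := by
  have h₀ : Continuous fun z : (LipCurve X × LipCurve X) × ℝ × ℝ => curveExt z.1.1 z.2.1 :=
    continuous_curveExt.comp (by fun_prop :
      Continuous fun z : (LipCurve X × LipCurve X) × ℝ × ℝ => (z.1.1, z.2.1))
  have h₁ : Continuous fun z : (LipCurve X × LipCurve X) × ℝ × ℝ => curveExt z.1.2 z.2.1 :=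
    continuous_curveExt.comp (by fun_prop :
      Continuous fun z : (LipCurve X × LipCurve X) × ℝ × ℝ => (z.1.2, z.2.1))
  have h₂ : Continuous fun z : (LipCurve X × LipCurve X) × ℝ × ℝ =>
      projIcc (0 : ℝ) 1 zero_le_one z.2.2 :=
    continuous_projIcc.comp (by fun_prop)
  exact hb.continuous.comp (h₀.prodMk (h₁.prodMk h₂))

theorem continuous_curveExt_geodesicCurve (hb : IsConicalGeodesicBicombing bic) (i : I) :
    Continuous (Function.uncurry fun (γ : LipCurve X × LipCurve X) (t : ℝ) =>
      curveExt (hb.geodesicCurve (γ.1.1 i) (γ.2.1 i)) t) := by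
  have h : Continuous fun z : (LipCurve X × LipCurve X) × ℝ =>
      ((z.1.1.1 i, z.1.2.1 i, projIcc (0 : ℝ) 1 zero_le_one z.2) : X × X × I) :=
    ((ContinuousEvalConst.continuous_eval_const i).comp
      (continuous_subtype_val.comp (by fun_prop))).prodMk
      (((ContinuousEvalConst.continuous_eval_const i).comp
      (continuous_subtype_val.comp (by fun_prop))).prodMk
        (continuous_projIcc.comp continuous_snd))
  exact hb.continuous.comp h

theorem edist_endpoints_le (γ₀ γ₁ : LipCurve X) :
    edist (γ₀.1 0) (γ₁.1 0) + edist (γ₀.1 1) (γ₁.1 1) ≤ 2 * edist γ₀ γ₁ := by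
  have h : ∀ i, edist (γ₀.1 i) (γ₁.1 i) ≤ edist γ₀ γ₁ := fun i => by
    rw [edist_dist, edist_dist]
    exact ENNReal.ofReal_le_ofReal (ContinuousMap.dist_apply_le_dist i)
  rw [two_mul]
  exact add_le_add (h 0) (h 1)

end Continuity

/-! ### Assembly of the homotopy lemma -/

section HomotopyLemma

variable {X : Type*} [MetricSpace X] [MeasurableSpace X] [BorelSpace X] {bic : X → X → I → X}

theorem measurable_borelExt_homotopyCurrent (hb : IsConicalGeodesicBicombing bic) {f : X → ℝ}
    (hf : Measurable f) (hfb : ∃ C : ℝ, ∀ x, |f x| ≤ C) (π : Fin 2 → LipFun X) :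
    Measurable[borel (LipCurve X × LipCurve X)] fun γ : LipCurve X × LipCurve X =>
      borelExt (homotopyCurrent bic γ.1 γ.2) f π := by
  have h := fun γ : LipCurve X × LipCurve X =>
    (isCurrentDensity_homotopyDensity hb γ.1 γ.2).borelExt_eq π hf hfb
  simp only [homotopyCurrent, h]
  -- The Borel structure of the product topology is installed directly: without separability of `X`
  -- it may be larger than the product of the Borel structures.
  let _ : MeasurableSpace (LipCurve X × LipCurve X) := borel _
  have : BorelSpace (LipCurve X × LipCurve X) := ⟨rfl⟩
  exact measurable_integral_mul_planarJacobian (continuous_geodesicHomotopy hb) hf (π 0) (π 1)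

theorem measurable_borelExt_endpointCurrent (hb : IsConicalGeodesicBicombing bic) {f : X → ℝ}
    (hf : Measurable f) (hfb : ∃ C : ℝ, ∀ x, |f x| ≤ C) (π : Fin 1 → LipFun X) :
    Measurable[borel (LipCurve X × LipCurve X)] fun γ : LipCurve X × LipCurve X =>
      borelExt (endpointCurrent hb γ.1 γ.2) f π := by
  have h := fun γ : LipCurve X × LipCurve X =>
    (isCurrentDensity_curveDensity (hb.lipschitzWith (γ.1.1 0) (γ.2.1 0))
      (γ := hb.geodesicCurve (γ.1.1 0) (γ.2.1 0))).borelExt_sub_eq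
    (isCurrentDensity_curveDensity (hb.lipschitzWith (γ.1.1 1) (γ.2.1 1))
      (γ := hb.geodesicCurve (γ.1.1 1) (γ.2.1 1))) π hf hfb
  simp only [endpointCurrent, curveCurrent_eq_densityFunctional, h]
  let _ : MeasurableSpace (LipCurve X × LipCurve X) := borel _
  have : BorelSpace (LipCurve X × LipCurve X) := ⟨rfl⟩
  exact (measurable_integral_mul_deriv (continuous_curveExt_geodesicCurve hb 0) hf (π 0)).sub
    (measurable_integral_mul_deriv (continuous_curveExt_geodesicCurve hb 1) hf (π 0))

theorem mass_endpointCurrent_le (hb : IsConicalGeodesicBicombing bic) (γ₀ γ₁ : LipCurve X) :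
    mass (endpointCurrent hb γ₀ γ₁) ≤
      edist (γ₀.1 0) (γ₁.1 0) + edist (γ₀.1 1) (γ₁.1 1) := by
  obtain ⟨μ₀, hμ₀, e₀⟩ := exists_massBound_curveCurrent
    (γ := hb.geodesicCurve (γ₀.1 0) (γ₁.1 0)) (hb.lipschitzWith _ _)
  obtain ⟨μ₁, hμ₁, e₁⟩ := exists_massBound_curveCurrent
    (γ := hb.geodesicCurve (γ₀.1 1) (γ₁.1 1)) (hb.lipschitzWith _ _)
  refine (mass_le_of_massBound (hμ₀.sub hμ₁)).trans_eq ?_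
  rw [Measure.add_apply, e₀, e₁, edist_nndist, edist_nndist]

theorem flatNorm_curveCurrent_sub_le (hb : IsConicalGeodesicBicombing bic) (γ₀ γ₁ : LipCurve X) :
    flatNorm (curveCurrent γ₀ - curveCurrent γ₁) ≤
      (curveLength γ₀ + curveLength γ₁ + 2) * edist γ₀ γ₁ := by
  refine (flatNorm_le (isNormalCurrent_homotopyCurrent hb γ₀ γ₁)
    (isMetricCurrent_endpointCurrent hb γ₀ γ₁) (curveCurrent_sub_eq hb γ₀ γ₁)).trans ?_
  rw [add_mul]
  exact add_le_add (mass_homotopyCurrent_le hb γ₀ γ₁)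
    ((mass_endpointCurrent_le hb γ₀ γ₁).trans (edist_endpoints_le γ₀ γ₁))

end HomotopyLemma

theorem lemma4p1 {X : Type*} [MetricSpace X] [CompleteSpace X] [MeasurableSpace X] [BorelSpace X]
    (hX : ∃ bic : X → X → I → X, IsConicalGeodesicBicombing bic) :
    ∃ (S : LipCurve X → LipCurve X → Functional X 2)
      (R : LipCurve X → LipCurve X → Functional X 1),
      (∀ γ₀ γ₁ : LipCurve X,
        IsMetricCurrent (S γ₀ γ₁) ∧
        IsMetricCurrent (R γ₀ γ₁) ∧
        curveCurrent γ₀ - curveCurrent γ₁ = boundary (S γ₀ γ₁) + R γ₀ γ₁ ∧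
        mass (S γ₀ γ₁) ≤ (curveLength γ₀ + curveLength γ₁) * edist γ₀ γ₁ ∧
        mass (R γ₀ γ₁) ≤ edist (γ₀.1 0) (γ₁.1 0) + edist (γ₀.1 1) (γ₁.1 1) ∧
        edist (γ₀.1 0) (γ₁.1 0) + edist (γ₀.1 1) (γ₁.1 1) ≤ 2 * edist γ₀ γ₁ ∧
        flatNorm (curveCurrent γ₀ - curveCurrent γ₁) ≤
          (curveLength γ₀ + curveLength γ₁ + 2) * edist γ₀ γ₁) ∧
      (∀ f : X → ℝ, Measurable f → (∃ C : ℝ, ∀ x, |f x| ≤ C) →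
        (∀ π₁ π₂ : LipFun X,
          Measurable[borel (LipCurve X × LipCurve X)]
            (fun γ : LipCurve X × LipCurve X => borelExt (S γ.1 γ.2) f ![π₁, π₂])) ∧
        (∀ π : LipFun X,
          Measurable[borel (LipCurve X × LipCurve X)]
            (fun γ : LipCurve X × LipCurve X => borelExt (R γ.1 γ.2) f ![π]))) := by
  obtain ⟨bic, hb⟩ := hX
  exact ⟨homotopyCurrent bic, endpointCurrent hb, fun γ₀ γ₁ =>
    ⟨isMetricCurrent_homotopyCurrent hb γ₀ γ₁, isMetricCurrent_endpointCurrent hb γ₀ γ₁,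
      curveCurrent_sub_eq hb γ₀ γ₁, mass_homotopyCurrent_le hb γ₀ γ₁,
      mass_endpointCurrent_le hb γ₀ γ₁, edist_endpoints_le γ₀ γ₁,
      flatNorm_curveCurrent_sub_le hb γ₀ γ₁⟩,
    fun f hf hfb => ⟨fun π₁ π₂ => measurable_borelExt_homotopyCurrent hb hf hfb _,
      fun π => measurable_borelExt_endpointCurrent hb hf hfb _⟩⟩
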